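/- Let $n\in\mathbb{N}\cup\{0\}$, $d\in\mathbb N$, $\tau\in(0,\infty)$, $x_0\in\mathbb{R}^d$, $p\in[2,\infty)$, $\alpha\in(0,1]$, put $T=(n+1)\tau$, and let $\|\cdot\|$ be the Euclidean norm. Let $f:[0,T]\times\mathbb{R}^d\times\mathbb{R}^d\to\mathbb{R}^d$ be such that $f(t,\cdot,\cdot)$ is continuous for every $t\in[0,T]$, $f(\cdot,x,z)$ is Borel measurable for all $x,z\in\mathbb{R}^d$, and there are $\bar K,L:[0,T]\to[0,\infty)$ in $L^p([0,T])$ such that for all $t\in[0,T]$ and $x_1,x_2,z_1,z_2\in\mathbb{R}^d$ \[ \|f(t,0,0)\|\le \bar K(t),\qquad \|f(t,x_1,z_1)-f(t,x_2,z_2)\|\le L(t)\bigl(\|x_1-x_2\|+\|z_1-z_2\|^{\alpha}\bigr). \] Let $x$ be the absolutely continuous solution of the delay equation $x'(t)=f(t,x(t),x(t-\tau))$ for almost every $t\in[0,T]$, with $x(t)=x_0$ for $t\in[-\tau,0]$. Let $(\gamma_k^j)_{j\ge 0,\,k\ge 1}$ be independent random variables on a probability space $\Omega$, each uniformly distributed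 on $[0,1]$. For an integer $N\ge 1$ put $h=\tau/N$, $t_k^j=j\tau+kh$, $y_0^{-1}=\dots=y_N^{-1}=x_0$ and, for $j=0,\dots,n$ and $k=0,\dots,N-1$, \[ y_0^j=y_N^{j-1},\qquad y_{k+1}^j=y_k^j+h\,f\bigl(t_k^j+h\gamma_{k+1}^j,\;y_k^j,\;y_k^{j-1}\bigr). \] Then there exist constants $C_0,\dots,C_n\in(0,\infty)$, not depending on $N$, such that for all integers $N\ge\lceil\tau\rceil$ and all $j=0,1,\dots,n$ \[ \Bigl\|\max_{0\le i\le N}\|x(t_i^j)-y_i^j\|\Bigr\|_{L^p(\Omega)}\le C_j\,h^{\frac12\alpha^j}. \] In particular, if $\alpha=1$, the left-hand side is at most $C_j h^{1/2}$ for all $j=0,1,\dots,n$. -/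

import Mathlib

open MeasureTheory ProbabilityTheory Set
open scoped ENNReal

/-- The assumptions on the right-hand side `f = f(t, x, z)` on the time interval `[0, T]`:
continuity in `(x, z)`, Borel measurability in `t`, and, with time weights `Kbar, L` in `L^p([0,T])`,
the bound on `f(t, 0, 0)` and the global Lipschitz (in `x`) / `α`-Hölder (in `z`) condition.
Nothing is assumed about `f(t, ·, ·)` for `t ∉ [0, T]`. -/
structure LipHolderRHS {d : ℕ}
    (f : ℝ → EuclideanSpace ℝ (Fin d) → EuclideanSpace ℝ (Fin d) → EuclideanSpace ℝ (Fin d))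
    (T p α : ℝ) : Prop where
  continuous_space : ∀ t ∈ Icc (0 : ℝ) T,
    Continuous fun q : EuclideanSpace ℝ (Fin d) × EuclideanSpace ℝ (Fin d) => f t q.1 q.2
  measurable_time : ∀ x z : EuclideanSpace ℝ (Fin d),
    Measurable ((Icc (0 : ℝ) T).domRestrict fun t => f t x z)
  exists_weights : ∃ Kbar L : ℝ → ℝ,
    (∀ t ∈ Icc (0 : ℝ) T, 0 ≤ Kbar t) ∧ (∀ t ∈ Icc (0 : ℝ) T, 0 ≤ L t) ∧
    MemLp Kbar (ENNReal.ofReal p) (volume.restrict (Icc (0 : ℝ) T)) ∧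
    MemLp L (ENNReal.ofReal p) (volume.restrict (Icc (0 : ℝ) T)) ∧
    (∀ t ∈ Icc (0 : ℝ) T, ‖f t 0 0‖ ≤ Kbar t) ∧
    ∀ t ∈ Icc (0 : ℝ) T, ∀ x₁ x₂ z₁ z₂ : EuclideanSpace ℝ (Fin d),
      ‖f t x₁ z₁ - f t x₂ z₂‖ ≤ L t * (‖x₁ - x₂‖ + ‖z₁ - z₂‖ ^ α)

/-- `x` is an absolutely continuous (Carathéodory) solution on `[0, T]` of the delay equation
`x'(t) = f(t, x(t), x(t - τ))` with constant initial history `x₀` on `[-τ, 0]`. -/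
structure IsDDESolution {d : ℕ}
    (f : ℝ → EuclideanSpace ℝ (Fin d) → EuclideanSpace ℝ (Fin d) → EuclideanSpace ℝ (Fin d))
    (T τ : ℝ) (x₀ : EuclideanSpace ℝ (Fin d)) (x : ℝ → EuclideanSpace ℝ (Fin d)) : Prop where
  initial : ∀ t ∈ Icc (-τ) 0, x t = x₀
  absolutelyContinuous : AbsolutelyContinuousOnInterval x 0 T
  equation : ∀ᵐ t ∂(volume.restrict (Icc (0 : ℝ) T)), HasDerivAt x (f t (x t) (x (t - τ))) t

/-- One block of Euler steps with step size `h` from time `t₀` and value `a`: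
`y_0 = a`, `y_{k+1} = y_k + h f(t₀ + k h + h u_k, y_k, w_k)`, with `w` the delayed values. -/
noncomputable def eulerBlock {d : ℕ}
    (f : ℝ → EuclideanSpace ℝ (Fin d) → EuclideanSpace ℝ (Fin d) → EuclideanSpace ℝ (Fin d))
    (h t₀ : ℝ) (u : ℕ → ℝ) (a : EuclideanSpace ℝ (Fin d)) (w : ℕ → EuclideanSpace ℝ (Fin d)) :
    ℕ → EuclideanSpace ℝ (Fin d)
  | 0 => a
  | k + 1 =>
      eulerBlock f h t₀ u a w k +
        h • f (t₀ + k * h + h * u k) (eulerBlock f h t₀ u a w k) (w k)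

/-- The Euler values with the block index shifted by one: `eulerShifted … (j + 1) k` is `y_k^j`,
and `eulerShifted … 0 k` is `y_k^{-1} = x₀`. Here `h = τ / N`, and `u j k` is the point of `[0, 1]`
used in the step from `y_k^j` to `y_{k+1}^j`. -/
noncomputable def eulerShifted {d : ℕ}
    (f : ℝ → EuclideanSpace ℝ (Fin d) → EuclideanSpace ℝ (Fin d) → EuclideanSpace ℝ (Fin d))
    (τ : ℝ) (x₀ : EuclideanSpace ℝ (Fin d)) (N : ℕ) (u : ℕ → ℕ → ℝ) :
    ℕ → ℕ → EuclideanSpace ℝ (Fin d)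
  | 0 => fun _ => x₀
  | j + 1 =>
      eulerBlock f (τ / N) (j * τ) (u j) (eulerShifted f τ x₀ N u j N) (eulerShifted f τ x₀ N u j)

/-- The randomized Euler scheme `y_k^j` (as a random vector). The variable `γ j k` is the one usually
written `γ_{k+1}^j`, so that `θ_{k+1}^j = j τ + k h + h * γ j k`. -/
noncomputable def randomizedEuler {d : ℕ} {Ω : Type*}
    (f : ℝ → EuclideanSpace ℝ (Fin d) → EuclideanSpace ℝ (Fin d) → EuclideanSpace ℝ (Fin d))
    (τ : ℝ) (x₀ : EuclideanSpace ℝ (Fin d)) (N : ℕ) (γ : ℕ → ℕ → Ω → ℝ) (j k : ℕ) (ω : Ω) :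
    EuclideanSpace ℝ (Fin d) :=
  eulerShifted f τ x₀ N (fun j' k' => γ j' k' ω) (j + 1) k

/-- The error on the `j`-th delay interval: `max_{0 ≤ i ≤ N} ‖x(t_i^j) - y_i^j‖`, where
`t_i^j = j τ + i h` and `h = τ / N`. -/
noncomputable def maxError {d : ℕ} {Ω : Type*}
    (f : ℝ → EuclideanSpace ℝ (Fin d) → EuclideanSpace ℝ (Fin d) → EuclideanSpace ℝ (Fin d))
    (τ : ℝ) (x₀ : EuclideanSpace ℝ (Fin d)) (x : ℝ → EuclideanSpace ℝ (Fin d))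
    (N : ℕ) (γ : ℕ → ℕ → Ω → ℝ) (j : ℕ) (ω : Ω) : ℝ :=
  (Finset.range (N + 1)).sup' Finset.nonempty_range_add_one fun i =>
    ‖x (j * τ + i * (τ / N)) - randomizedEuler f τ x₀ N γ j i ω‖

/-! Put `F s = f s (x s) (x (s - τ))`. On one delay interval, inserting `h • F θ` at the random node
`θ` writes the error as the error inherited at the left end, plus a sum of randomized quadrature
errors, plus a sum of `h • (F θ - f θ y w)`, where `w` is the delayed value.

The quadrature errors are independent and centered because `h • F θ` has mean equal to the integral
of `F` over the cell. A maximal moment inequality for such sums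
(`exists_lintegral_partialSups_rpow_le`) bounds their maximum in `L^p` by a constant times `h ^
(1/2)`, using no regularity of `f` in time.

The remaining terms are at most `h * L θ * (‖e‖ + ‖e'‖ ^ α + r)`, with `e` and `e'` the current and
delayed errors and `r` the oscillation of the solution over a cell. As `L` is only in `L^p`, a
pathwise Grönwall argument would give an exponential of a sum of the `L θ`, whose moments need not
exist. But `θ` is independent of `e` and `e'`, so the expectation of the `p`-th power factorizes,
and Grönwall is applied to the resulting deterministic recursion for moments
(`lintegral_sup_rpow_le_of_le_add_sum`). Its coefficients are integrals of `L ^ p` over disjoint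
cells, hence summable uniformly in `N`.

The solution is 1/2-Hölder because `F` is square integrable. Jensen's inequality turns the delayed
error into the `α`-th power of the previous bound, so each interval multiplies the exponent by `α`.
The measurability gaps of `f` are removed by changing it on a null set of times, which the random
nodes almost surely avoid. -/

/-! ### Elementary inequalities for powers. -/

/-- Second-order upper bound for `‖s + d‖ ^ p`, `p ≥ 2`, in an inner product space. -/
theorem exists_norm_add_rpow_le {E : Type*} [NormedAddCommGroup E] [InnerProductSpace ℝ E]
    {p : ℝ} (hp : 2 ≤ p) :
    ∃ C : ℝ, 0 ≤ C ∧ ∀ s d : E,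
      ‖s + d‖ ^ p ≤ ‖s‖ ^ p + p * ‖s‖ ^ (p - 2) * inner ℝ s d
        + C * (‖s‖ ^ (p - 2) * ‖d‖ ^ (2 : ℝ) + ‖d‖ ^ p) := by
  have hp0 : 0 < p := by linarith
  set q := p / 2 with hq
  have hq1 : 1 ≤ q := by rw [hq]; linarith
  have hpq : p = 2 * q := by rw [hq]; ring
  -- Threshold between two regimes: `‖s‖ > K * ‖d‖` forces `|q * w| ≤ 1` below.
  set K := 3 * q with hK
  have hK0 : 0 < K := by positivity
  -- The first two summands serve large `‖s‖` (the `‖d‖ ^ 2` inside `w`, then the quadratic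
  -- remainder). The last two serve small `‖s‖`, where every term is comparable to `‖d‖ ^ p`.
  refine ⟨q + 9 * q ^ 2 + (K + 1) ^ p + p * K ^ (p - 1), by positivity, fun s d => ?_⟩
  have hinner : |inner ℝ s d| ≤ ‖s‖ * ‖d‖ := abs_real_inner_le_norm s d
  have hd0 := norm_nonneg d
  rcases le_or_gt ‖s‖ (K * ‖d‖) with hsd | hsd
  · have h1 : ‖s + d‖ ^ p ≤ (K + 1) ^ p * ‖d‖ ^ p := by
      rw [← Real.mul_rpow (by positivity) hd0]
      refine Real.rpow_le_rpow (norm_nonneg _) ?_ hp0.le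
      linarith [norm_add_le s d]
    have h2 : -(p * K ^ (p - 1) * ‖d‖ ^ p) ≤ p * ‖s‖ ^ (p - 2) * inner ℝ s d := by
      rcases (norm_nonneg s).eq_or_lt with hs | hs
      · have : s = 0 := norm_eq_zero.1 hs.symm
        subst this
        simp only [inner_zero_left, mul_zero]
        have : 0 ≤ p * K ^ (p - 1) * ‖d‖ ^ p := by positivity
        linarith
      · have hdpos : 0 < ‖d‖ := by
          by_contra h
          have : ‖d‖ = 0 := le_antisymm (not_lt.1 h) hd0
          rw [this] at hsd; linarith
        have h3 : ‖s‖ ^ (p - 2) * (‖s‖ * ‖d‖) ≤ K ^ (p - 1) * ‖d‖ ^ p := by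
          calc ‖s‖ ^ (p - 2) * (‖s‖ * ‖d‖) = ‖s‖ ^ (p - 1) * ‖d‖ := by
                rw [show p - 1 = (p - 2) + 1 by ring, Real.rpow_add hs, Real.rpow_one]; ring
            _ ≤ (K * ‖d‖) ^ (p - 1) * ‖d‖ := by
                gcongr
                linarith
            _ = K ^ (p - 1) * ‖d‖ ^ p := by
                rw [Real.mul_rpow hK0.le hd0]
                have : ‖d‖ ^ p = ‖d‖ ^ (p - 1) * ‖d‖ := by
                  rw [← Real.rpow_add_one hdpos.ne']; ring_nf
                rw [this]; ring
        have h4 : -(‖s‖ * ‖d‖) ≤ inner ℝ s d := (abs_le.1 hinner).1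
        have h5 : 0 ≤ ‖s‖ ^ (p - 2) := by positivity
        have h6 : ‖s‖ ^ (p - 2) * -(‖s‖ * ‖d‖) ≤ ‖s‖ ^ (p - 2) * inner ℝ s d :=
          mul_le_mul_of_nonneg_left h4 h5
        have h7 : -(K ^ (p - 1) * ‖d‖ ^ p) ≤ ‖s‖ ^ (p - 2) * inner ℝ s d := by linarith
        have := mul_le_mul_of_nonneg_left h7 hp0.le
        linarith
    have h8 : 0 ≤ ‖s‖ ^ p := by positivity
    have h9 : 0 ≤ (q + 9 * q ^ 2) * ‖d‖ ^ p := by positivity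
    have h10 : 0 ≤ (q + 9 * q ^ 2 + (K + 1) ^ p + p * K ^ (p - 1)) *
      (‖s‖ ^ (p - 2) * ‖d‖ ^ (2 : ℝ)) := by positivity
    nlinarith
  · have hs : 0 < ‖s‖ := lt_of_le_of_lt (by positivity) hsd
    set w := (2 * inner ℝ s d + ‖d‖ ^ 2) / ‖s‖ ^ 2 with hw
    have hds : ‖d‖ ≤ ‖s‖ := by nlinarith
    have hnum : |2 * inner ℝ s d + ‖d‖ ^ 2| ≤ 3 * (‖s‖ * ‖d‖) := by
      have h := abs_le.1 hinner
      rw [abs_le]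
      constructor <;> nlinarith
    have hwabs : |w| ≤ 3 * ‖d‖ / ‖s‖ := by
      rw [hw, abs_div, abs_of_pos (by positivity : 0 < ‖s‖ ^ 2), div_le_div_iff₀ (by positivity) hs]
      nlinarith
    have hqw : |q * w| ≤ 1 := by
      rw [abs_mul, abs_of_pos (by positivity : 0 < q)]
      calc q * |w| ≤ q * (3 * ‖d‖ / ‖s‖) := by gcongr
        _ ≤ 1 := by
          rw [← mul_div_assoc, div_le_one hs]
          linarith
    have hnorm : ‖s + d‖ ^ 2 = ‖s‖ ^ 2 * (1 + w) := by
      rw [norm_add_sq_real, hw]; field_simp; ring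
    have hw1 : 0 ≤ 1 + w := by
      have h : 0 ≤ ‖s‖ ^ 2 * (1 + w) := hnorm ▸ sq_nonneg _
      exact nonneg_of_mul_nonneg_right h (by positivity)
    have hpow : ‖s + d‖ ^ p = ‖s‖ ^ p * (1 + w) ^ q := by
      have h := congrArg (fun r => r ^ q) hnorm
      rw [Real.mul_rpow (by positivity) hw1, ← Real.rpow_natCast, ← Real.rpow_natCast,
        ← Real.rpow_mul (norm_nonneg _), ← Real.rpow_mul (norm_nonneg _)] at h
      rw [hpq]; exact_mod_cast h
    -- Passing through `1 + w ≤ exp w` replaces a Taylor expansion of a real power by the remainder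
    -- bound for `exp` on `[-1, 1]`.
    have hexp : (1 + w) ^ q ≤ 1 + q * w + (q * w) ^ 2 := by
      calc (1 + w) ^ q ≤ (Real.exp w) ^ q := by
            gcongr; linarith [Real.add_one_le_exp w]
        _ = Real.exp (q * w) := by rw [← Real.exp_mul, mul_comm]
        _ ≤ _ := by linarith [(abs_le.1 (Real.abs_exp_sub_one_sub_id_le hqw)).2]
    have hsp : ‖s‖ ^ p = ‖s‖ ^ (p - 2) * ‖s‖ ^ 2 := by
      rw [← Real.rpow_natCast, ← Real.rpow_add hs]; norm_num
    have hlin : ‖s‖ ^ p * (q * w) =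
        p * ‖s‖ ^ (p - 2) * inner ℝ s d + q * (‖s‖ ^ (p - 2) * ‖d‖ ^ 2) := by
      rw [hsp, hw, hpq]; field_simp
    have hquad : ‖s‖ ^ p * (q * w) ^ 2 ≤ 9 * q ^ 2 * (‖s‖ ^ (p - 2) * ‖d‖ ^ 2) := by
      have h1 : w ^ 2 ≤ (3 * ‖d‖ / ‖s‖) ^ 2 := by
        rw [← sq_abs w]; gcongr
      calc ‖s‖ ^ p * (q * w) ^ 2 ≤ ‖s‖ ^ p * (q ^ 2 * (3 * ‖d‖ / ‖s‖) ^ 2) := by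
            rw [mul_pow]; gcongr
        _ = _ := by rw [hsp]; field_simp; ring
    have h2 : ‖d‖ ^ (2 : ℝ) = ‖d‖ ^ 2 := by norm_cast
    rw [h2, hpow]
    have h3 : ‖s‖ ^ p * (1 + w) ^ q ≤ ‖s‖ ^ p * (1 + q * w + (q * w) ^ 2) := by gcongr
    have h4 : 0 ≤ ((K + 1) ^ p + p * K ^ (p - 1)) * (‖s‖ ^ (p - 2) * ‖d‖ ^ 2) := by positivity
    have h5 : 0 ≤ (q + 9 * q ^ 2 + (K + 1) ^ p + p * K ^ (p - 1)) * ‖d‖ ^ p := by positivity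
    nlinarith

/-- Young's inequality with explicit weights, by comparing `b ^ 2` with `a ^ 2 / r`. Taken with `r =
N`, it is the source of the factor `N ^ (p / 2 - 1)` in the moment bound. -/
theorem rpow_sub_two_mul_sq_le {p : ℝ} (hp : 2 ≤ p) {a b r : ℝ} (ha : 0 ≤ a) (hb : 0 ≤ b)
    (hr : 0 < r) :
    a ^ (p - 2) * b ^ (2 : ℝ) ≤ a ^ p / r + r ^ (p / 2 - 1) * b ^ p := by
  have hap : a ^ p = a ^ (p - 2) * a ^ (2 : ℝ) := by
    rw [← Real.rpow_add_of_nonneg ha (by linarith) (by norm_num)]; ring_nf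
  have hbp : b ^ p = b ^ (p - 2) * b ^ (2 : ℝ) := by
    rw [← Real.rpow_add_of_nonneg hb (by linarith) (by norm_num)]; ring_nf
  rcases le_or_gt (b ^ (2 : ℝ)) (a ^ (2 : ℝ) / r) with h | h
  · have h1 : a ^ (p - 2) * b ^ (2 : ℝ) ≤ a ^ p / r := by
      rw [hap, mul_div_assoc]; gcongr
    have h2 : 0 ≤ r ^ (p / 2 - 1) * b ^ p := by positivity
    linarith
  · have h1 : a ^ (p - 2) ≤ r ^ (p / 2 - 1) * b ^ (p - 2) := by
      have e : ∀ c : ℝ, 0 ≤ c → c ^ (p - 2) = (c ^ (2 : ℝ)) ^ (p / 2 - 1) := fun c hc => by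
        rw [← Real.rpow_mul hc]; ring_nf
      rw [e a ha, e b hb, ← Real.mul_rpow hr.le (by positivity)]
      refine Real.rpow_le_rpow (by positivity) ?_ (by linarith)
      rw [div_lt_iff₀ hr] at h; linarith
    have h2 : a ^ (p - 2) * b ^ (2 : ℝ) ≤ r ^ (p / 2 - 1) * b ^ p := by
      rw [hbp, ← mul_assoc]; gcongr
    have h3 : 0 ≤ a ^ p / r := by positivity
    linarith

/-- Young's inequality for `a * b ^ (p - 1)`. It describes a jump of the running maximum from `b` to
`a`. -/
theorem rpow_sub_rpow_le {p : ℝ} (hp : 1 < p) {a b : ℝ} (ha : 0 ≤ a) (hb : 0 ≤ b) :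
    (p - 1) / p * (a ^ p - b ^ p) ≤ (a ^ (p - 1) - b ^ (p - 1)) * a := by
  have hp0 : 0 < p := by linarith
  have hconj : p.HolderConjugate (p / (p - 1)) := Real.HolderConjugate.conjExponent hp
  have hy := Real.young_inequality_of_nonneg ha (Real.rpow_nonneg hb (p - 1)) hconj
  rw [← Real.rpow_mul hb, mul_div_cancel₀ _ (by linarith : p - 1 ≠ 0)] at hy
  have hap : a ^ (p - 1) * a = a ^ p := by
    nth_rewrite 2 [← Real.rpow_one a]
    rw [← Real.rpow_add_of_nonneg ha (by linarith) (by norm_num)]; ring_nf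
  have h1 : b ^ p / (p / (p - 1)) = (p - 1) / p * b ^ p := by
    field_simp
  have h2 : a ^ p = a ^ p / p + (p - 1) / p * a ^ p := by field_simp; ring
  rw [sub_mul, hap]
  linarith

/-- Pathwise form of Doob's `L^p` maximal inequality. -/
theorem partialSups_rpow_add_sum_le {p : ℝ} (hp : 1 < p) {s : ℕ → ℝ} (hs : ∀ i, 0 ≤ s i)
    (hs0 : s 0 = 0) (N : ℕ) :
    (p - 1) / p * (partialSups s N) ^ p
        + ∑ i ∈ Finset.range N, (partialSups s i) ^ (p - 1) * (s (i + 1) - s i)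
      ≤ (partialSups s N) ^ (p - 1) * s N := by
  induction N with
  | zero => simp [hs0, Real.zero_rpow (by linarith : p ≠ 0)]
  | succ N ih =>
    have hm : 0 ≤ partialSups s N := (hs 0).trans (le_partialSups_of_le s (Nat.zero_le N))
    have hm' : 0 ≤ partialSups s (N + 1) := (hs 0).trans (le_partialSups_of_le s (Nat.zero_le _))
    -- The maximum moves only when it equals the new value `s (N + 1)`; otherwise both sides vanish.
    -- Summation by parts then gives the claim.
    have key : (p - 1) / p * ((partialSups s (N + 1)) ^ p - (partialSups s N) ^ p) ≤
        ((partialSups s (N + 1)) ^ (p - 1) - (partialSups s N) ^ (p - 1)) * s (N + 1) := by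
      have h := partialSups_add_one s N
      rcases le_total (s (N + 1)) (partialSups s N) with h1 | h1
      · rw [sup_eq_left.2 h1] at h
        simp [h]
      · rw [sup_eq_right.2 h1] at h
        have := rpow_sub_rpow_le hp hm' hm
        rwa [← h]
    rw [Finset.sum_range_succ]
    nlinarith

/-- Young's inequality in absorbing form: the power of the maximum receives an arbitrarily small
coefficient `c`. -/
theorem rpow_sub_one_mul_le {p c : ℝ} (hp : 1 ≤ p) (hc : 0 < c) {a b : ℝ} (ha : 0 ≤ a)
    (hb : 0 ≤ b) : a ^ (p - 1) * b ≤ c * a ^ p + (c⁻¹) ^ (p - 1) * b ^ p := by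
  have e : ∀ x : ℝ, 0 ≤ x → x ^ (p - 1) * x = x ^ p := fun x hx => by
    nth_rewrite 2 [← Real.rpow_one x]
    rw [← Real.rpow_add_of_nonneg hx (by linarith) (by norm_num)]; ring_nf
  rcases le_or_gt b (c * a) with h | h
  · have h1 : a ^ (p - 1) * b ≤ c * a ^ p := by
      rw [← e a ha]
      calc a ^ (p - 1) * b ≤ a ^ (p - 1) * (c * a) := by gcongr
        _ = _ := by ring
    have : 0 ≤ (c⁻¹) ^ (p - 1) * b ^ p := by positivity
    linarith
  · have h1 : a ^ (p - 1) * b ≤ (c⁻¹) ^ (p - 1) * b ^ p := by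
      rw [← e b hb, ← mul_assoc, ← Real.mul_rpow (by positivity) hb]
      refine mul_le_mul_of_nonneg_right (Real.rpow_le_rpow ha ?_ (by linarith)) hb
      rw [le_inv_mul_iff₀ hc]; exact h.le
    have : 0 ≤ c * a ^ p := by positivity
    linarith

/-! ### Discrete Grönwall, independence from the past, running maxima. -/

/-- Discrete Grönwall inequality in `ℝ≥0∞`. -/
theorem ENNReal.le_mul_prod_of_le_add_sum {a : ℝ≥0∞} {b u : ℕ → ℝ≥0∞} {N : ℕ}
    (h : ∀ m ≤ N, u m ≤ a + ∑ l ∈ Finset.range m, b l * u l) :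
    ∀ m ≤ N, u m ≤ a * ∏ l ∈ Finset.range m, (1 + b l) := by
  -- The product solves the recursion with equality, so strong induction compares `u` with it. No
  -- finiteness of `u` is assumed, which allows moments not yet known to be finite.
  have key : ∀ m : ℕ, a + ∑ l ∈ Finset.range m, b l * (a * ∏ k ∈ Finset.range l, (1 + b k))
      = a * ∏ l ∈ Finset.range m, (1 + b l) := by
    intro m
    induction m with
    | zero => simp
    | succ m ih => rw [Finset.sum_range_succ, ← add_assoc, ih, Finset.prod_range_succ]; ring
  intro m
  induction m using Nat.strong_induction_on with
  | _ m ih =>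
    intro hm
    refine (h m hm).trans ?_
    rw [← key m]
    gcongr with l hl
    have hl' := Finset.mem_range.1 hl
    exact ih l hl' (hl'.le.trans hm)

theorem ENNReal.prod_one_add_ofReal_le {b : ℕ → ℝ} (hb : ∀ l, 0 ≤ b l) (m : ℕ) :
    ∏ l ∈ Finset.range m, (1 + ENNReal.ofReal (b l))
      ≤ ENNReal.ofReal (Real.exp (∑ l ∈ Finset.range m, b l)) := by
  have : ∏ l ∈ Finset.range m, (1 + ENNReal.ofReal (b l))
      = ENNReal.ofReal (∏ l ∈ Finset.range m, (1 + b l)) := by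
    rw [ENNReal.ofReal_prod_of_nonneg fun i _ => by linarith [hb i]]
    refine Finset.prod_congr rfl fun i _ => ?_
    rw [ENNReal.ofReal_add zero_le_one (hb i), ENNReal.ofReal_one]
  rw [this]
  exact ENNReal.ofReal_le_ofReal (Real.prod_one_add_le_exp_sum _ fun i => hb i)

/-- Independence is read off from disjoint index sets, so the past is an index set and no filtration
is needed. -/
theorem iIndepFun.indepFun_of_measurable_iSup {Ω ι β γ δ : Type*} {mΩ : MeasurableSpace Ω}
    [mβ : MeasurableSpace β] [MeasurableSpace γ] [MeasurableSpace δ] {P : Measure Ω}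
    {X : ι → Ω → β} (hX : iIndepFun X P) (hXm : ∀ i, Measurable (X i)) {S T : Set ι}
    (hST : Disjoint S T) {U : Ω → γ} {V : Ω → δ}
    (hU : Measurable[⨆ i ∈ S, mβ.comap (X i)] U) (hV : Measurable[⨆ i ∈ T, mβ.comap (X i)] V) :
    IndepFun U V P := by
  have h := indep_iSup_of_disjoint (fun i => (hXm i).comap_le) hX hST
  exact indep_of_indep_of_le_left (indep_of_indep_of_le_right h hV.comap_le) hU.comap_le

theorem measurable_iSup_comap_of_mem {Ω ι β : Type*} [mβ : MeasurableSpace β] {X : ι → Ω → β}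
    {S : Set ι} {i : ι} (hi : i ∈ S) : Measurable[⨆ i ∈ S, mβ.comap (X i)] (X i) :=
  measurable_iff_comap_le.2 (le_iSup₂ (f := fun i (_ : i ∈ S) => mβ.comap (X i)) i hi)

/-- The σ-algebra is a variable because it is also taken to be that of the past. -/
theorem measurable_partialSups {Ω : Type*} {m : MeasurableSpace Ω} {s : ℕ → Ω → ℝ} {N : ℕ}
    (hs : ∀ i ≤ N, Measurable (s i)) : Measurable fun ω => partialSups (fun i => s i ω) N := by
  induction N with
  | zero => simpa using hs 0 le_rfl
  | succ N ih =>
    simp only [partialSups_add_one]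
    exact (ih fun i hi => hs i (hi.trans N.le_succ)).sup (hs (N + 1) le_rfl)

theorem partialSups_rpow_le_sum {p : ℝ} {s : ℕ → ℝ} (hs : ∀ i, 0 ≤ s i) (N : ℕ) :
    (partialSups s N) ^ p ≤ ∑ i ∈ Finset.range (N + 1), s i ^ p := by
  induction N with
  | zero => simp
  | succ N ih =>
    rw [partialSups_add_one, Finset.sum_range_succ]
    have h1 : 0 ≤ ∑ i ∈ Finset.range (N + 1), s i ^ p :=
      Finset.sum_nonneg fun i _ => Real.rpow_nonneg (hs i) p
    have h2 := Real.rpow_nonneg (hs (N + 1)) p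
    rcases max_cases (partialSups s N) (s (N + 1)) with h | h
    · rw [h.1]; linarith
    · rw [h.1]; linarith

section

variable {E : Type*} [NormedAddCommGroup E] [InnerProductSpace ℝ E]

theorem norm_rpow_smul_self {p : ℝ} (hp : 1 < p) (s : E) : ‖‖s‖ ^ (p - 2) • s‖ = ‖s‖ ^ (p - 1) := by
  rw [norm_smul, Real.norm_of_nonneg (by positivity)]
  rcases (norm_nonneg s).eq_or_lt with h | h
  · rw [← h, Real.zero_rpow (by linarith : p - 1 ≠ 0), mul_zero]
  · rw [← Real.rpow_add_one h.ne']; ring_nf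

/-- `s / ‖s‖` is a subgradient of the norm at `s`, by Cauchy–Schwarz; at `s = 0` the convention `0⁻¹
= 0` suffices. This replaces the submartingale property of the norms of the partial sums. -/
theorem inner_smul_div_norm_le (s d : E) {r : ℝ} (hr : 0 ≤ r) :
    inner ℝ ((r * ‖s‖⁻¹) • s) d ≤ r * (‖s + d‖ - ‖s‖) := by
  rw [inner_smul_left, conj_trivial, mul_assoc]
  refine mul_le_mul_of_nonneg_left ?_ hr
  rcases (norm_nonneg s).eq_or_lt with h | h
  · rw [← h]; simp
  · rw [inv_mul_le_iff₀ h]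
    have h1 : inner ℝ s (s + d) ≤ ‖s‖ * ‖s + d‖ := real_inner_le_norm _ _
    rw [inner_add_right, real_inner_self_eq_norm_sq] at h1
    nlinarith

end

/-! ### Moment and maximal inequalities for independent centered sums. -/

section IndependentSums

variable {E : Type*} [NormedAddCommGroup E] [InnerProductSpace ℝ E] [FiniteDimensional ℝ E]
  [MeasurableSpace E] [BorelSpace E] {Ω : Type*} [MeasurableSpace Ω] {P : Measure Ω}
  [IsProbabilityMeasure P]

-- Orthogonality of martingale increments: `V` will be a function of the past and `D` the next
-- increment.
omit [IsProbabilityMeasure P] in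
theorem integral_inner_eq_zero_of_indepFun {V D : Ω → E} (h : IndepFun V D P)
    (hV : Integrable V P) (hD : Integrable D P) (h0 : ∫ ω, D ω ∂P = 0) :
    Integrable (fun ω => inner ℝ (V ω) (D ω)) P ∧ ∫ ω, inner ℝ (V ω) (D ω) ∂P = 0 := by
  have := FiniteDimensional.complete ℝ E
  have := FiniteDimensional.proper ℝ E
  constructor
  · exact h.integrable_bilin hV hD (innerSL ℝ)
  · have := h.integral_bilin hV hD (innerSL ℝ)
    exact this.trans (by simp [h0])

/-- Rests on `m ^ (p - 1) ≤ 1 + m ^ p`. -/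
theorem integrable_smul_of_norm_le_rpow {p : ℝ} (hp : 1 ≤ p) {V : Ω → E} {m : Ω → ℝ} {c : ℝ}
    (hV : Measurable V) (hm : ∀ ω, 0 ≤ m ω)
    (hi : Integrable (fun ω => m ω ^ p) P) (hc : 0 ≤ c) (h : ∀ ω, ‖V ω‖ ≤ c * m ω ^ (p - 1)) :
    Integrable V P := by
  have := FiniteDimensional.proper ℝ E
  refine Integrable.mono' (((integrable_const (1 : ℝ)).add hi).const_mul c)
    hV.aestronglyMeasurable (ae_of_all _ fun ω => (h ω).trans ?_)
  refine mul_le_mul_of_nonneg_left ?_ hc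
  have h1 : 0 ≤ m ω ^ p := Real.rpow_nonneg (hm ω) p
  simp only [Pi.add_apply]
  rcases le_total (m ω) 1 with h2 | h2
  · have : m ω ^ (p - 1) ≤ 1 := Real.rpow_le_one (hm ω) h2 (by linarith)
    linarith
  · have : m ω ^ (p - 1) ≤ m ω ^ p := Real.rpow_le_rpow_of_exponent_le h2 (by linarith)
    linarith

variable {D : ℕ → Ω → E}

omit [MeasurableSpace Ω] in
theorem measurable_sum_range_iSup_comap (i : ℕ) :
    Measurable[⨆ l ∈ Iio i, ‹MeasurableSpace E›.comap (D l)]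
      fun ω => ∑ l ∈ Finset.range i, D l ω :=
  Finset.measurable_sum _ fun _ hl => measurable_iSup_comap_of_mem (Finset.mem_range.1 hl)

omit [NormedAddCommGroup E] [InnerProductSpace ℝ E] [FiniteDimensional ℝ E] [BorelSpace E]
  [IsProbabilityMeasure P] in
theorem indepFun_of_measurable_past (hD : iIndepFun D P) (hm : ∀ l, Measurable (D l)) {i : ℕ}
    {V : Ω → E} (hV : Measurable[⨆ l ∈ Iio i, ‹MeasurableSpace E›.comap (D l)] V) :
    IndepFun V (D i) P :=
  iIndepFun.indepFun_of_measurable_iSup hD hm (S := Iio i) (T := {i}) (by simp) hV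
    (measurable_iSup_comap_of_mem (mem_singleton i))

omit [InnerProductSpace ℝ E] [FiniteDimensional ℝ E] [MeasurableSpace E] [BorelSpace E]
  [IsProbabilityMeasure P] in
theorem integrable_norm_sum_rpow {p : ℝ} (hp : 1 ≤ p)
    (hLp : ∀ l, MemLp (D l) (ENNReal.ofReal p) P) (i : ℕ) :
    Integrable (fun ω => ‖∑ l ∈ Finset.range i, D l ω‖ ^ p) P := by
  have h : MemLp (fun ω => ∑ l ∈ Finset.range i, D l ω) (ENNReal.ofReal p) P :=
    memLp_finsetSum _ fun l _ => hLp l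
  have := h.integrable_norm_rpow (by simp; linarith) (by simp)
  rwa [ENNReal.toReal_ofReal (by linarith)] at this

/-- Moment bound of order `p ≥ 2` for sums of independent centered random vectors. -/
theorem exists_integral_norm_sum_rpow_le {p : ℝ} (hp : 2 ≤ p) :
    ∃ C : ℝ, 0 ≤ C ∧ ∀ D : ℕ → Ω → E, (∀ l, Measurable (D l)) →
      (∀ l, MemLp (D l) (ENNReal.ofReal p) P) → (∀ l, ∫ ω, D l ω ∂P = 0) → iIndepFun D P →
      ∀ N : ℕ, 0 < N →
        ∫ ω, ‖∑ l ∈ Finset.range N, D l ω‖ ^ p ∂P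
          ≤ C * (N : ℝ) ^ (p / 2 - 1) * ∑ l ∈ Finset.range N, ∫ ω, ‖D l ω‖ ^ p ∂P := by
  have := FiniteDimensional.proper ℝ E
  obtain ⟨C, hC, hbound⟩ := exists_norm_add_rpow_le (E := E) hp
  have hp0 : 0 < p := by linarith
  refine ⟨Real.exp C * (2 * C), by positivity, fun D hm hLp hmean hind N hN => ?_⟩
  have hN' : (0 : ℝ) < N := Nat.cast_pos.2 hN
  have hN1 : (1 : ℝ) ≤ (N : ℝ) ^ (p / 2 - 1) :=
    Real.one_le_rpow (by exact_mod_cast hN) (by linarith)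
  set a : ℕ → ℝ := fun i => ∫ ω, ‖∑ l ∈ Finset.range i, D l ω‖ ^ p ∂P with ha
  set b : ℕ → ℝ := fun i => ∫ ω, ‖D i ω‖ ^ p ∂P with hb
  have hb0 : ∀ i, 0 ≤ b i := fun i => integral_nonneg fun ω => by positivity
  have hDint : ∀ i, Integrable (fun ω => ‖D i ω‖ ^ p) P := fun i => by
    have := (hLp i).integrable_norm_rpow (by simp; linarith) (by simp)
    rwa [ENNReal.toReal_ofReal (by linarith)] at this
  have hD1 : ∀ i, Integrable (D i) P := fun i =>
    (hLp i).integrable (by rw [← ENNReal.ofReal_one]; exact ENNReal.ofReal_le_ofReal (by linarith))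
  have hSint := fun i => integrable_norm_sum_rpow (by linarith : 1 ≤ p) hLp i
  -- In the second-order expansion the linear term has mean zero. Young's inequality with `r = N`
  -- leaves a growth factor whose `N`-th power is at most `exp C`.
  have hstep : ∀ i, a (i + 1) ≤ (1 + C / N) * a i + 2 * C * (N : ℝ) ^ (p / 2 - 1) * b i := by
    intro i
    set S : Ω → E := fun ω => ∑ l ∈ Finset.range i, D l ω with hS
    have hSm : Measurable S := Finset.measurable_sum _ fun l _ => hm l
    -- Up to the factor `p`, the gradient of `‖·‖ ^ p` at `S`; it depends on the earlier increments
    -- only.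
    set V : Ω → E := fun ω => ‖S ω‖ ^ (p - 2) • S ω with hV
    have hVi : Integrable V P :=
      integrable_smul_of_norm_le_rpow (p := p) (m := fun ω => ‖S ω‖) (c := 1) (by linarith)
        ((hSm.norm.pow_const _).smul hSm) (fun ω => norm_nonneg _) (hSint i) zero_le_one
        (fun ω => by rw [one_mul]; exact (norm_rpow_smul_self (by linarith) (S ω)).le)
    have hVind : IndepFun V (D i) P := by
      refine indepFun_of_measurable_past hind hm ?_
      have h := measurable_sum_range_iSup_comap (D := D) i
      exact ((measurable_norm.comp h).pow_const _).smul h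
    obtain ⟨hVD, hVD0⟩ := integral_inner_eq_zero_of_indepFun hVind hVi (hD1 i) (hmean i)
    have hpt : ∀ ω, ‖∑ l ∈ Finset.range (i + 1), D l ω‖ ^ p ≤
        (1 + C / N) * ‖S ω‖ ^ p + p * inner ℝ (V ω) (D i ω)
          + 2 * C * (N : ℝ) ^ (p / 2 - 1) * ‖D i ω‖ ^ p := by
      intro ω
      rw [Finset.sum_range_succ]
      have h1 := hbound (S ω) (D i ω)
      have h2 := rpow_sub_two_mul_sq_le hp (norm_nonneg (S ω)) (norm_nonneg (D i ω)) hN'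
      have h3 : 0 ≤ ‖D i ω‖ ^ p := by positivity
      have h4 : ‖D i ω‖ ^ p ≤ (N : ℝ) ^ (p / 2 - 1) * ‖D i ω‖ ^ p := le_mul_of_one_le_left h3 hN1
      have h5 : C * (‖S ω‖ ^ (p - 2) * ‖D i ω‖ ^ (2 : ℝ) + ‖D i ω‖ ^ p) ≤
          C * (‖S ω‖ ^ p / N + (N : ℝ) ^ (p / 2 - 1) * ‖D i ω‖ ^ p
            + (N : ℝ) ^ (p / 2 - 1) * ‖D i ω‖ ^ p) :=
        mul_le_mul_of_nonneg_left (by linarith) hC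
      have h6 : inner ℝ (V ω) (D i ω) = ‖S ω‖ ^ (p - 2) * inner ℝ (S ω) (D i ω) := by
        rw [hV]; simp only [inner_smul_left, conj_trivial]
      rw [h6]
      have h7 : C * (‖S ω‖ ^ p / N + (N : ℝ) ^ (p / 2 - 1) * ‖D i ω‖ ^ p
            + (N : ℝ) ^ (p / 2 - 1) * ‖D i ω‖ ^ p)
          = C / N * ‖S ω‖ ^ p + 2 * C * (N : ℝ) ^ (p / 2 - 1) * ‖D i ω‖ ^ p := by ring
      linarith
    have hi1 := (hSint i).const_mul (1 + C / N)
    have hi2 := hVD.const_mul p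
    have hi3 := (hDint i).const_mul (2 * C * (N : ℝ) ^ (p / 2 - 1))
    have h := integral_mono (hSint (i + 1)) ((hi1.add hi2).add hi3) hpt
    rw [integral_add' (hi1.add hi2) hi3, integral_add' hi1 hi2, integral_const_mul,
      integral_const_mul, integral_const_mul, hVD0] at h
    simpa using h
  have hind' : ∀ i, a i ≤ (1 + C / N) ^ i *
      (2 * C * (N : ℝ) ^ (p / 2 - 1) * ∑ l ∈ Finset.range i, b l) := by
    intro i
    induction i with
    | zero => simp [ha, Real.zero_rpow hp0.ne']
    | succ i ih =>
      have h1 : (1 : ℝ) ≤ (1 + C / N) ^ (i + 1) := one_le_pow₀ (by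
        have : 0 ≤ C / N := by positivity
        linarith)
      have h2 : 0 ≤ 2 * C * (N : ℝ) ^ (p / 2 - 1) * b i := by have := hb0 i; positivity
      calc a (i + 1) ≤ (1 + C / N) * a i + 2 * C * (N : ℝ) ^ (p / 2 - 1) * b i := hstep i
        _ ≤ (1 + C / N) * ((1 + C / N) ^ i *
              (2 * C * (N : ℝ) ^ (p / 2 - 1) * ∑ l ∈ Finset.range i, b l))
            + (1 + C / N) ^ (i + 1) * (2 * C * (N : ℝ) ^ (p / 2 - 1) * b i) :=
          add_le_add (mul_le_mul_of_nonneg_left ih (by positivity)) (le_mul_of_one_le_left h2 h1)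
        _ = _ := by rw [Finset.sum_range_succ]; ring
  have hexp : (1 + C / N) ^ N ≤ Real.exp C := by
    calc (1 + C / N) ^ N ≤ (Real.exp (C / N)) ^ N := by
          gcongr; linarith [Real.add_one_le_exp (C / N)]
      _ = Real.exp C := by rw [← Real.exp_nat_mul]; congr 1; field_simp
  have hsum : 0 ≤ ∑ l ∈ Finset.range N, b l := Finset.sum_nonneg fun l _ => hb0 l
  calc a N ≤ (1 + C / N) ^ N * (2 * C * (N : ℝ) ^ (p / 2 - 1) * ∑ l ∈ Finset.range N, b l) :=
        hind' N
    _ ≤ Real.exp C * (2 * C * (N : ℝ) ^ (p / 2 - 1) * ∑ l ∈ Finset.range N, b l) := by gcongr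
    _ = _ := by ring

/-- Doob's `L^p` inequality for the norms of partial sums of independent centered vectors. -/
theorem integral_partialSups_rpow_le {p : ℝ} (hp : 2 ≤ p) (hm : ∀ l, Measurable (D l))
    (hLp : ∀ l, MemLp (D l) (ENNReal.ofReal p) P) (hmean : ∀ l, ∫ ω, D l ω ∂P = 0)
    (hind : iIndepFun D P) (N : ℕ) :
    Integrable (fun ω => (partialSups (fun i => ‖∑ l ∈ Finset.range i, D l ω‖) N) ^ p) P ∧
    ∫ ω, (partialSups (fun i => ‖∑ l ∈ Finset.range i, D l ω‖) N) ^ p ∂P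
      ≤ 4 * 4 ^ (p - 1) * ∫ ω, ‖∑ l ∈ Finset.range N, D l ω‖ ^ p ∂P := by
  have := FiniteDimensional.proper ℝ E
  have hp0 : 0 < p := by linarith
  set S : ℕ → Ω → E := fun i ω => ∑ l ∈ Finset.range i, D l ω with hS
  set M : ℕ → Ω → ℝ := fun i ω => partialSups (fun i => ‖S i ω‖) i with hM
  have hM0 : ∀ i ω, 0 ≤ M i ω := fun i ω =>
    (norm_nonneg (S 0 ω)).trans (le_partialSups_of_le (fun i => ‖S i ω‖) (Nat.zero_le i))
  have hSint := fun i => integrable_norm_sum_rpow (by linarith : 1 ≤ p) hLp i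
  have hSm : ∀ i, Measurable (S i) := fun i => Finset.measurable_sum _ fun l _ => hm l
  have hMm : ∀ i, Measurable (M i) := fun i => measurable_partialSups fun k _ => (hSm k).norm
  have hMint : ∀ i, Integrable (fun ω => M i ω ^ p) P := fun i => by
    refine Integrable.mono' (integrable_finsetSum (Finset.range (i + 1)) fun k _ => hSint k)
      ((hMm i).pow_const p).aestronglyMeasurable (ae_of_all _ fun ω => ?_)
    rw [Real.norm_of_nonneg (Real.rpow_nonneg (hM0 i ω) p)]
    exact partialSups_rpow_le_sum (fun k => norm_nonneg (S k ω)) i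
  have hD1 : ∀ i, Integrable (D i) P := fun i =>
    (hLp i).integrable (by rw [← ENNReal.ofReal_one]; exact ENNReal.ofReal_le_ofReal (by linarith))
  -- The weight from the pathwise Doob inequality times the subgradient of the norm. It is a
  -- function of the past, so pairing it with `D i` has mean zero.
  set V : ℕ → Ω → E := fun i ω => (M i ω ^ (p - 1) * ‖S i ω‖⁻¹) • S i ω with hV
  have hVi : ∀ i, Integrable (V i) P := fun i => by
    refine integrable_smul_of_norm_le_rpow (p := p) (m := M i) (c := 1) (by linarith)
      ((((hMm i).pow_const _).mul (hSm i).norm.inv).smul (hSm i)) (hM0 i) (hMint i)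
      zero_le_one fun ω => ?_
    have h0 := Real.rpow_nonneg (hM0 i ω) (p - 1)
    rw [hV, one_mul, norm_smul, norm_mul, Real.norm_of_nonneg h0, norm_inv, norm_norm, mul_assoc]
    refine mul_le_of_le_one_right h0 ?_
    exact inv_mul_le_one
  have hVind : ∀ i, IndepFun (V i) (D i) P := fun i => by
    refine indepFun_of_measurable_past hind hm ?_
    have hpast : ∀ k ≤ i, Measurable[⨆ l ∈ Iio i, ‹MeasurableSpace E›.comap (D l)] (S k) :=
      fun k hk => Finset.measurable_sum _ fun l hl =>
        measurable_iSup_comap_of_mem ((Finset.mem_range.1 hl).trans_le hk)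
    have h := hpast i le_rfl
    have h' : Measurable[⨆ l ∈ Iio i, ‹MeasurableSpace E›.comap (D l)] (M i) :=
      measurable_partialSups fun k hk => measurable_norm.comp (hpast k hk)
    exact ((h'.pow_const _).mul (measurable_norm.comp h).inv).smul h
  have hVD := fun i => integral_inner_eq_zero_of_indepFun (hVind i) (hVi i) (hD1 i) (hmean i)
  -- Since `(p - 1) / p ≥ 1 / 2`, Young's inequality with `c = 1 / 4` absorbs half of that
  -- coefficient and produces `4 ^ (p - 1)`.
  have hpt : ∀ ω, 1 / 4 * M N ω ^ p + ∑ i ∈ Finset.range N, inner ℝ (V i ω) (D i ω)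
      ≤ 4 ^ (p - 1) * ‖S N ω‖ ^ p := by
    intro ω
    have h1 := partialSups_rpow_add_sum_le (by linarith : 1 < p) (s := fun i => ‖S i ω‖)
      (fun i => norm_nonneg _) (by simp [hS]) N
    have h2 : ∑ i ∈ Finset.range N, inner ℝ (V i ω) (D i ω) ≤
        ∑ i ∈ Finset.range N, M i ω ^ (p - 1) * (‖S (i + 1) ω‖ - ‖S i ω‖) := by
      refine Finset.sum_le_sum fun i _ => ?_
      have h := inner_smul_div_norm_le (S i ω) (D i ω) (Real.rpow_nonneg (hM0 i ω) (p - 1))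
      have hs : S (i + 1) ω = S i ω + D i ω := by rw [hS]; simp only [Finset.sum_range_succ]
      rw [hs]; exact h
    have h3 := rpow_sub_one_mul_le (by linarith : 1 ≤ p) (by norm_num : (0 : ℝ) < 1 / 4)
      (hM0 N ω) (norm_nonneg (S N ω))
    have h4 : (1 : ℝ) / 2 ≤ (p - 1) / p := by rw [div_le_div_iff₀ two_pos hp0]; linarith
    have h5 := mul_le_mul_of_nonneg_right h4 (Real.rpow_nonneg (hM0 N ω) p)
    norm_num at h3
    linarith
  have hi1 := (hMint N).const_mul (1 / 4)
  have hi2 : Integrable (fun ω => ∑ i ∈ Finset.range N, inner ℝ (V i ω) (D i ω)) P :=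
    integrable_finsetSum _ fun i _ => (hVD i).1
  have h := integral_mono (hi1.add hi2) ((hSint N).const_mul (4 ^ (p - 1))) hpt
  rw [integral_add' hi1 hi2, integral_const_mul, integral_const_mul,
    integral_finsetSum _ fun i _ => (hVD i).1, Finset.sum_eq_zero fun i _ => (hVD i).2] at h
  exact ⟨hMint N, by linarith⟩

/-- Maximal inequality of Marcinkiewicz–Zygmund type for independent centered random vectors. -/
theorem exists_lintegral_partialSups_rpow_le {p : ℝ} (hp : 2 ≤ p) :
    ∃ C : ℝ, 0 ≤ C ∧ ∀ D : ℕ → Ω → E, (∀ l, Measurable (D l)) →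
      (∀ l, MemLp (D l) (ENNReal.ofReal p) P) → (∀ l, ∫ ω, D l ω ∂P = 0) → iIndepFun D P →
      ∀ N : ℕ, 0 < N →
        ∫⁻ ω, ENNReal.ofReal (partialSups (fun i => ‖∑ l ∈ Finset.range i, D l ω‖) N) ^ p ∂P
          ≤ ENNReal.ofReal (C * (N : ℝ) ^ (p / 2 - 1))
            * ∑ l ∈ Finset.range N, ∫⁻ ω, ‖D l ω‖ₑ ^ p ∂P := by
  have hp0 : 0 < p := by linarith
  obtain ⟨C, hC, h⟩ := exists_integral_norm_sum_rpow_le (E := E) (P := P) hp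
  refine ⟨4 * 4 ^ (p - 1) * C, by positivity, fun D hm hLp hmean hind N hN => ?_⟩
  obtain ⟨h1, h2⟩ := integral_partialSups_rpow_le hp hm hLp hmean hind N
  have h3 := h2.trans (mul_le_mul_of_nonneg_left (h D hm hLp hmean hind N hN) (by positivity))
  have hM0 : ∀ ω, 0 ≤ partialSups (fun i => ‖∑ l ∈ Finset.range i, D l ω‖) N := fun ω =>
    (norm_nonneg _).trans
      (le_partialSups_of_le (fun i => ‖∑ l ∈ Finset.range i, D l ω‖) (Nat.zero_le N))
  have hDint : ∀ l, ∫⁻ ω, ‖D l ω‖ₑ ^ p ∂P = ENNReal.ofReal (∫ ω, ‖D l ω‖ ^ p ∂P) := fun l => by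
    have := (hLp l).integrable_norm_rpow (by simp; linarith) (by simp)
    rw [ENNReal.toReal_ofReal (by linarith)] at this
    rw [ofReal_integral_eq_lintegral_ofReal this (ae_of_all _ fun ω => by positivity)]
    refine lintegral_congr fun ω => ?_
    rw [← ENNReal.ofReal_rpow_of_nonneg (norm_nonneg _) hp0.le, ofReal_norm]
  have e1 : ∫⁻ ω, ENNReal.ofReal (partialSups (fun i => ‖∑ l ∈ Finset.range i, D l ω‖) N) ^ p ∂P
      = ENNReal.ofReal
        (∫ ω, (partialSups (fun i => ‖∑ l ∈ Finset.range i, D l ω‖) N) ^ p ∂P) := by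
    rw [ofReal_integral_eq_lintegral_ofReal h1
      (ae_of_all _ fun ω => Real.rpow_nonneg (hM0 ω) p)]
    refine lintegral_congr fun ω => ?_
    rw [← ENNReal.ofReal_rpow_of_nonneg (hM0 ω) hp0.le]
  have h0 : ∀ l, 0 ≤ ∫ ω, ‖D l ω‖ ^ p ∂P := fun l => integral_nonneg fun ω => by positivity
  rw [e1, Finset.sum_congr rfl fun l _ => hDint l,
    ← ENNReal.ofReal_sum_of_nonneg fun l _ => h0 l, ← ENNReal.ofReal_mul (by positivity)]
  refine ENNReal.ofReal_le_ofReal (h3.trans (le_of_eq ?_))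
  ring

end IndependentSums

/-! ### Uniform nodes and randomized quadrature. -/

/-- Serves twice: to turn expectations at a random node into cell averages, and to show that nodes
avoid null sets of times. -/
theorem map_const_add_mul_of_isUniform {Ω : Type*} [MeasurableSpace Ω] {P : Measure Ω}
    {g : Ω → ℝ} (hg : Measurable g) (hu : pdf.IsUniform g (Icc (0 : ℝ) 1) P volume)
    (t : ℝ) {h : ℝ} (hh : 0 < h) :
    P.map (fun ω => t + h * g ω)
      = ENNReal.ofReal h⁻¹ • (volume.restrict (Icc t (t + h))) := by
  have hm : Measurable fun u : ℝ => t + h * u := by fun_prop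
  have h1 : P.map g = volume.restrict (Icc (0 : ℝ) 1) := by
    rw [hu, ProbabilityTheory.cond]; simp
  have h2 : (volume : Measure ℝ).map (fun u : ℝ => t + h * u) = ENNReal.ofReal h⁻¹ • volume := by
    have : (fun u : ℝ => t + h * u) = (fun v => t + v) ∘ (fun u => h * u) := rfl
    rw [this, ← Measure.map_map (by fun_prop) (by fun_prop), Real.map_volume_mul_left hh.ne',
      Measure.map_smul, map_add_left_eq_self, abs_of_pos (inv_pos.2 hh)]
  have h3 : (fun u : ℝ => t + h * u) ⁻¹' (Icc t (t + h)) = Icc 0 1 := by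
    ext u
    simp only [mem_preimage, mem_Icc, le_add_iff_nonneg_right, add_le_add_iff_left]
    rw [mul_nonneg_iff_of_pos_left hh, mul_le_iff_le_one_right hh]
  have h4 : (fun ω => t + h * g ω) = (fun u : ℝ => t + h * u) ∘ g := rfl
  rw [h4, ← Measure.map_map hm hg, h1, ← h3, ← Measure.restrict_map hm measurableSet_Icc, h2,
    Measure.restrict_smul]

theorem lintegral_comp_uniform {Ω : Type*} [MeasurableSpace Ω] {P : Measure Ω}
    {g : Ω → ℝ} (hg : Measurable g) (hu : pdf.IsUniform g (Icc (0 : ℝ) 1) P volume)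
    (t : ℝ) {h : ℝ} (hh : 0 < h) {φ : ℝ → ℝ≥0∞} (hφ : Measurable φ) :
    ∫⁻ ω, φ (t + h * g ω) ∂P = ENNReal.ofReal h⁻¹ * ∫⁻ s in Icc t (t + h), φ s := by
  rw [← lintegral_map (f := φ) (g := fun ω => t + h * g ω) hφ (by fun_prop),
    map_const_add_mul_of_isUniform hg hu t hh, lintegral_smul_measure, smul_eq_mul]

/-- The closed cells overlap only at endpoints; up to null sets they are half-open cells tiling one
interval. -/
theorem sum_setLIntegral_Icc_le (φ : ℝ → ℝ≥0∞) (t : ℝ) {h : ℝ} (hh : 0 ≤ h) (N : ℕ) :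
    ∑ l ∈ Finset.range N, ∫⁻ s in Icc (t + l * h) (t + l * h + h), φ s ≤ ∫⁻ s, φ s := by
  have key : ∑ l ∈ Finset.range N, ∫⁻ s in Icc (t + l * h) (t + l * h + h), φ s
      = ∫⁻ s in Ioc t (t + N * h), φ s := by
    induction N with
    | zero => simp
    | succ N ih =>
      have h0 : (0 : ℝ) ≤ N * h := by positivity
      rw [Finset.sum_range_succ, ih, setLIntegral_congr Ioc_ae_eq_Icc.symm,
        ← lintegral_union measurableSet_Ioc (Set.Ioc_disjoint_Ioc_of_le le_rfl),
        Ioc_union_Ioc_eq_Ioc (by linarith) (by linarith)]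
      push_cast
      ring_nf
  rw [key]
  exact setLIntegral_le_lintegral _ _

section Quadrature

variable {E : Type*} [NormedAddCommGroup E] [InnerProductSpace ℝ E] [FiniteDimensional ℝ E]
  [MeasurableSpace E] [BorelSpace E] {Ω : Type*} [MeasurableSpace Ω] {P : Measure Ω}
  [IsProbabilityMeasure P]

-- Minkowski's inequality, and the norm of the mean is at most the `L^p` norm.
omit [FiniteDimensional ℝ E] [MeasurableSpace E] [BorelSpace E] in
theorem lintegral_enorm_integral_sub_rpow_le {p : ℝ} (hp : 1 ≤ p) {Y : Ω → E}
    (hY : MemLp Y (ENNReal.ofReal p) P) :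
    ∫⁻ ω, ‖(∫ ω', Y ω' ∂P) - Y ω‖ₑ ^ p ∂P ≤ 2 ^ p * ∫⁻ ω, ‖Y ω‖ₑ ^ p ∂P := by
  have hp0 : 0 < p := by linarith
  have hq0 : ENNReal.ofReal p ≠ 0 := by simpa using hp0
  have hq1 : 1 ≤ ENNReal.ofReal p := by
    rw [← ENNReal.ofReal_one]; exact ENNReal.ofReal_le_ofReal hp
  have e : ∀ Z : Ω → E, ∫⁻ ω, ‖Z ω‖ₑ ^ p ∂P = eLpNorm Z (ENNReal.ofReal p) P ^ p := fun Z => by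
    rw [eLpNorm_eq_lintegral_rpow_enorm_toReal hq0 ENNReal.ofReal_ne_top,
      ENNReal.toReal_ofReal hp0.le, ← ENNReal.rpow_mul, one_div, inv_mul_cancel₀ hp0.ne',
      ENNReal.rpow_one]
  rw [e, e, ← ENNReal.mul_rpow_of_nonneg _ _ hp0.le]
  refine ENNReal.rpow_le_rpow ?_ hp0.le
  have h1 : ‖∫ ω', Y ω' ∂P‖ₑ ≤ eLpNorm Y (ENNReal.ofReal p) P := by
    refine (enorm_integral_le_lintegral_enorm Y).trans ?_
    rw [← eLpNorm_one_eq_lintegral_enorm]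
    exact eLpNorm_le_eLpNorm_of_exponent_le hq1 hY.1
  calc eLpNorm ((fun _ => ∫ ω', Y ω' ∂P) - Y) (ENNReal.ofReal p) P
      ≤ eLpNorm (fun _ => ∫ ω', Y ω' ∂P) (ENNReal.ofReal p) P + eLpNorm Y (ENNReal.ofReal p) P :=
        eLpNorm_sub_le aestronglyMeasurable_const hY.1 hq1
    _ ≤ eLpNorm Y (ENNReal.ofReal p) P + eLpNorm Y (ENNReal.ofReal p) P := by
        gcongr
        rw [eLpNorm_const _ hq0 (IsProbabilityMeasure.ne_zero P)]
        simpa using h1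
    _ = 2 * eLpNorm Y (ENNReal.ofReal p) P := (two_mul _).symm

/-- The error of one step of the randomized quadrature `∫_t^{t+h} F ≈ h F(t + h u)`. -/
noncomputable def quadratureError (F : ℝ → E) (t h u : ℝ) : E :=
  (∫ s in t..t + h, F s) - h • F (t + h * u)

theorem measurable_quadratureError {F : ℝ → E} (hF : Measurable F) (t h : ℝ) :
    Measurable (quadratureError F t h) := by
  have := FiniteDimensional.proper ℝ E
  exact measurable_const.sub ((hF.comp (by fun_prop)).const_smul h)

/-- With `Y = F (t + h * g)`, the error is `h` times the mean of `Y` minus `Y`, hence centered. The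
power `h ^ (p - 1)` is `h ^ p` from this factor times `h⁻¹` from the uniform density. -/
theorem quadratureError_moments {p : ℝ} (hp : 1 ≤ p) {F : ℝ → E} (hF : Measurable F)
    (hFp : MemLp F (ENNReal.ofReal p) volume) {g : Ω → ℝ} (hg : Measurable g)
    (hu : pdf.IsUniform g (Icc (0 : ℝ) 1) P volume) (t : ℝ) {h : ℝ} (hh : 0 < h) :
    MemLp (fun ω => quadratureError F t h (g ω)) (ENNReal.ofReal p) P ∧
    ∫ ω, quadratureError F t h (g ω) ∂P = 0 ∧
    ∫⁻ ω, ‖quadratureError F t h (g ω)‖ₑ ^ p ∂P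
      ≤ ENNReal.ofReal (2 ^ p * h ^ (p - 1)) * ∫⁻ s in Icc t (t + h), ‖F s‖ₑ ^ p := by
  have hproper := FiniteDimensional.proper ℝ E
  have hcomplete := FiniteDimensional.complete ℝ E
  have hp0 : 0 < p := by linarith
  have hθ : Measurable fun ω => t + h * g ω := by fun_prop
  set Y : Ω → E := fun ω => F (t + h * g ω) with hYdef
  have hmap := map_const_add_mul_of_isUniform hg hu t hh
  have hY : MemLp Y (ENNReal.ofReal p) P := by
    have : MemLp F (ENNReal.ofReal p) (P.map fun ω => t + h * g ω) := by
      rw [hmap]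
      exact (hFp.restrict _).smul_measure ENNReal.ofReal_ne_top
    exact this.comp_of_map hθ.aemeasurable
  have hY1 : Integrable Y P := hY.integrable (by
    rw [← ENNReal.ofReal_one]; exact ENNReal.ofReal_le_ofReal hp)
  have hEY : ∫ ω, Y ω ∂P = h⁻¹ • ∫ s in t..t + h, F s := by
    rw [← integral_map (f := F) hθ.aemeasurable hF.aestronglyMeasurable, hmap,
      integral_smul_measure, ENNReal.toReal_ofReal (inv_nonneg.2 hh.le),
      intervalIntegral.integral_of_le (by linarith), integral_Icc_eq_integral_Ioc]
  have hD : (fun ω => quadratureError F t h (g ω)) = fun ω => h • ((∫ ω', Y ω' ∂P) - Y ω) := by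
    funext ω
    rw [hEY, smul_sub, smul_inv_smul₀ hh.ne', quadratureError]
  refine ⟨?_, ?_, ?_⟩
  · rw [hD]
    exact ((memLp_const _).sub hY).const_smul h
  · rw [hD, integral_smul, integral_sub (integrable_const _) hY1]
    simp
  · have h1 : ∀ ω, ‖quadratureError F t h (g ω)‖ₑ ^ p
        = ENNReal.ofReal (h ^ p) * ‖(∫ ω', Y ω' ∂P) - Y ω‖ₑ ^ p := fun ω => by
      rw [congrFun hD ω, enorm_smul, ENNReal.mul_rpow_of_nonneg _ _ hp0.le,
        Real.enorm_of_nonneg hh.le, ENNReal.ofReal_rpow_of_nonneg hh.le hp0.le]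
    have h2 : ∫⁻ ω, ‖Y ω‖ₑ ^ p ∂P
        = ENNReal.ofReal h⁻¹ * ∫⁻ s in Icc t (t + h), ‖F s‖ₑ ^ p :=
      lintegral_comp_uniform hg hu t hh (φ := fun s => ‖F s‖ₑ ^ p) (hF.enorm.pow_const p)
    rw [lintegral_congr h1, lintegral_const_mul' _ _ ENNReal.ofReal_ne_top]
    refine (mul_le_mul_right (lintegral_enorm_integral_sub_rpow_le hp hY) _).trans (le_of_eq ?_)
    rw [h2, ← mul_assoc, ← mul_assoc]
    congr 1
    have h3 : (2 : ℝ≥0∞) ^ p = ENNReal.ofReal (2 ^ p) := by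
      rw [← ENNReal.ofReal_rpow_of_pos two_pos]; simp
    rw [h3, ← ENNReal.ofReal_mul (by positivity), ← ENNReal.ofReal_mul (by positivity),
      Real.rpow_sub_one hh.ne']
    congr 1
    field_simp

/-- Maximal `L^p` error of the randomized rectangle rule along an equidistant grid. -/
theorem exists_lintegral_partialSups_quadratureError_le {p : ℝ} (hp : 2 ≤ p) :
    ∃ C : ℝ, 0 ≤ C ∧ ∀ F : ℝ → E, Measurable F → MemLp F (ENNReal.ofReal p) volume →
      ∀ g : ℕ → Ω → ℝ, (∀ l, Measurable (g l)) →
      (∀ l, pdf.IsUniform (g l) (Icc (0 : ℝ) 1) P volume) → iIndepFun g P →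
      ∀ (t h : ℝ), 0 < h → ∀ N : ℕ, 0 < N →
        ∫⁻ ω, ENNReal.ofReal (partialSups (fun i =>
            ‖∑ l ∈ Finset.range i, quadratureError F (t + l * h) h (g l ω)‖) N) ^ p ∂P
          ≤ ENNReal.ofReal (C * (N * h) ^ (p / 2 - 1) * h ^ (p / 2)) * ∫⁻ s, ‖F s‖ₑ ^ p := by
  obtain ⟨C, hC, hmax⟩ := exists_lintegral_partialSups_rpow_le (E := E) (P := P) hp
  refine ⟨C * 2 ^ p, by positivity, fun F hF hFp g hg hu hind t h hh N hN => ?_⟩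
  have hq := fun l : ℕ =>
    quadratureError_moments (by linarith : 1 ≤ p) hF hFp (hg l) (hu l) (t + l * h) hh
  have hqm := fun l : ℕ => measurable_quadratureError hF (t + l * h) h
  have hm := hmax (fun l ω => quadratureError F (t + l * h) h (g l ω))
    (fun l => (hqm l).comp (hg l)) (fun l => (hq l).1) (fun l => (hq l).2.1)
    (hind.comp (fun l => quadratureError F (t + l * h) h) hqm) N hN
  refine hm.trans ?_
  have hN' : (0 : ℝ) < N := Nat.cast_pos.2 hN
  calc ENNReal.ofReal (C * (N : ℝ) ^ (p / 2 - 1)) * ∑ l ∈ Finset.range N,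
        ∫⁻ ω, ‖quadratureError F (t + l * h) h (g l ω)‖ₑ ^ p ∂P
      ≤ ENNReal.ofReal (C * (N : ℝ) ^ (p / 2 - 1)) * ∑ l ∈ Finset.range N,
        ENNReal.ofReal (2 ^ p * h ^ (p - 1)) *
          ∫⁻ s in Icc (t + l * h) (t + l * h + h), ‖F s‖ₑ ^ p := by
        gcongr with l _
        exact (hq l).2.2
    _ ≤ ENNReal.ofReal (C * (N : ℝ) ^ (p / 2 - 1)) *
        (ENNReal.ofReal (2 ^ p * h ^ (p - 1)) * ∫⁻ s, ‖F s‖ₑ ^ p) := by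
        rw [← Finset.mul_sum]
        gcongr
        exact sum_setLIntegral_Icc_le _ t hh.le N
    -- `N ^ (p / 2 - 1) * h ^ (p - 1) = (N * h) ^ (p / 2 - 1) * h ^ (p / 2)`, and `N * h` is the
    -- length of the interval: this is the rate 1/2.
    _ = _ := by
        rw [← mul_assoc, ← ENNReal.ofReal_mul (by positivity), Real.mul_rpow hN'.le hh.le]
        congr 2
        rw [show p - 1 = (p / 2 - 1) + p / 2 by ring, Real.rpow_add hh]
        ring

end Quadrature

/-! ### Stochastic Grönwall inequality. -/

theorem ENNReal.ofReal_two_rpow (p : ℝ) : ENNReal.ofReal (2 ^ p) = (2 : ℝ≥0∞) ^ p := by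
  rw [← ENNReal.ofReal_rpow_of_pos two_pos]; simp

theorem ENNReal.rpow_add_add_le {p : ℝ} (hp : 1 < p) (x y z : ℝ≥0∞) :
    (x + y + z) ^ p ≤ 2 ^ (p - 1) * 2 ^ (p - 1) * (x ^ p + y ^ p + z ^ p) := by
  have h1 : (1 : ℝ≥0∞) ≤ 2 ^ (p - 1) := ENNReal.one_le_rpow one_le_two (by linarith)
  calc (x + y + z) ^ p ≤ 2 ^ (p - 1) * ((x + y) ^ p + z ^ p) :=
        ENNReal.rpow_add_le_mul_rpow_add_rpow _ _ hp.le
    _ ≤ 2 ^ (p - 1) * (2 ^ (p - 1) * (x ^ p + y ^ p) + 2 ^ (p - 1) * z ^ p) := by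
        gcongr
        · exact ENNReal.rpow_add_le_mul_rpow_add_rpow _ _ hp.le
        · exact le_mul_of_one_le_left' h1
    _ = _ := by ring

/-- Stochastic Grönwall estimate for a recursion with random coefficients `Λ l` that are
independent of the current state. -/
theorem lintegral_sup_rpow_le_of_le_add_sum {Ω : Type*} [MeasurableSpace Ω] {P : Measure Ω}
    {p : ℝ} (hp : 1 < p) {N : ℕ} {h : ℝ} (hh : 0 ≤ h) {X W Λ : ℕ → Ω → ℝ≥0∞} {A : Ω → ℝ≥0∞}
    [IsProbabilityMeasure P]
    {r w : ℝ≥0∞} {β : ℕ → ℝ} (hβ : ∀ l, 0 ≤ β l)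
    (hX : ∀ l, Measurable (X l)) (hW : ∀ l, Measurable (W l)) (hΛ : ∀ l, Measurable (Λ l))
    (hA : Measurable A)
    (hle : ∀ᵐ ω ∂P, ∀ i ≤ N,
      X i ω ≤ A ω + ∑ l ∈ Finset.range i, ENNReal.ofReal h * (Λ l ω * (X l ω + W l ω + r)))
    (hXΛ : ∀ l < N, IndepFun (X l) (Λ l) P) (hWΛ : ∀ l < N, IndepFun (W l) (Λ l) P)
    (hΛβ : ∀ l < N, ENNReal.ofReal (N ^ (p - 1) * h ^ p) * ∫⁻ ω, Λ l ω ^ p ∂P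
      ≤ ENNReal.ofReal (β l))
    (hWw : ∀ l < N, ∫⁻ ω, W l ω ^ p ∂P ≤ w) :
    ∫⁻ ω, ((Finset.range (N + 1)).sup fun i => X i ω) ^ p ∂P ≤
      ENNReal.ofReal (8 ^ (p - 1)) *
        (∫⁻ ω, A ω ^ p ∂P + ENNReal.ofReal (∑ l ∈ Finset.range N, β l) * (w + r ^ p)) *
        ENNReal.ofReal (Real.exp (8 ^ (p - 1) * ∑ l ∈ Finset.range N, β l)) := by
  have hp0 : 0 < p := by linarith
  set κ : ℝ≥0∞ := 2 ^ (p - 1) with hκ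
  have hκ1 : 1 ≤ κ := ENNReal.one_le_rpow one_le_two (by linarith)
  have h8 : ENNReal.ofReal (8 ^ (p - 1)) = κ * (κ * κ) := by
    have : (8 : ℝ) ^ (p - 1) = 2 ^ (p - 1) * (2 ^ (p - 1) * 2 ^ (p - 1)) := by
      rw [← Real.mul_rpow, ← Real.mul_rpow] <;> norm_num
    rw [this, ENNReal.ofReal_mul (by positivity), ENNReal.ofReal_mul (by positivity),
      ENNReal.ofReal_two_rpow]
  -- The recursion is run for this majorant instead of `X`: it is nondecreasing in `m`, so `Z N`
  -- dominates every `X i` and the maximum costs nothing extra.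
  set Z : ℕ → Ω → ℝ≥0∞ := fun m ω =>
    A ω + ∑ l ∈ Finset.range m, ENNReal.ofReal h * (Λ l ω * (X l ω + W l ω + r)) with hZ
  have hZmono : ∀ {i m : ℕ}, i ≤ m → ∀ ω, Z i ω ≤ Z m ω := fun {i m} him ω => by
    simp only [hZ]
    gcongr
  -- Only `Λ l` against `X l` and `Λ l` against `W l` must be independent, since the product is
  -- expanded before the expectations are split.
  have hterm : ∀ l < N, ∫⁻ ω, Λ l ω ^ p * (X l ω ^ p + W l ω ^ p + r ^ p) ∂P
      ≤ (∫⁻ ω, Λ l ω ^ p ∂P) * (∫⁻ ω, X l ω ^ p ∂P + (w + r ^ p)) := by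
    intro l hl
    have m1 : Measurable fun ω => Λ l ω ^ p := (hΛ l).pow_const p
    have m2 : Measurable fun ω => X l ω ^ p := (hX l).pow_const p
    have m3 : Measurable fun ω => W l ω ^ p := (hW l).pow_const p
    have i1 : ∫⁻ ω, Λ l ω ^ p * X l ω ^ p ∂P = (∫⁻ ω, Λ l ω ^ p ∂P) * ∫⁻ ω, X l ω ^ p ∂P :=
      lintegral_mul_eq_lintegral_mul_lintegral_of_indepFun m1 m2
        ((hXΛ l hl).symm.comp (φ := fun y => y ^ p) (ψ := fun y => y ^ p)
          (measurable_id.pow_const p) (measurable_id.pow_const p))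
    have i2 : ∫⁻ ω, Λ l ω ^ p * W l ω ^ p ∂P = (∫⁻ ω, Λ l ω ^ p ∂P) * ∫⁻ ω, W l ω ^ p ∂P :=
      lintegral_mul_eq_lintegral_mul_lintegral_of_indepFun m1 m3
        ((hWΛ l hl).symm.comp (φ := fun y => y ^ p) (ψ := fun y => y ^ p)
          (measurable_id.pow_const p) (measurable_id.pow_const p))
    simp only [mul_add]
    have m4 : Measurable fun ω => Λ l ω ^ p * X l ω ^ p := m1.mul m2
    have m5 : Measurable fun ω => Λ l ω ^ p * X l ω ^ p + Λ l ω ^ p * W l ω ^ p :=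
      m4.add (m1.mul m3)
    rw [lintegral_add_left m5, lintegral_add_left m4, i1, i2, lintegral_mul_const _ m1, add_assoc]
    gcongr
    exact hWw l hl
  -- Hölder's inequality for the sum gives `N ^ (p - 1)`. Of the three factors `κ`, one separates
  -- `A` from the sum and two split the three summands.
  have hZpow : ∀ m ≤ N, ∀ ω, Z m ω ^ p ≤ κ * A ω ^ p + ∑ l ∈ Finset.range m,
      κ * (κ * κ) * (ENNReal.ofReal (N ^ (p - 1) * h ^ p) *
        (Λ l ω ^ p * (X l ω ^ p + W l ω ^ p + r ^ p))) := by
    intro m hm ω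
    have h1 := ENNReal.rpow_sum_le_const_mul_sum_rpow (Finset.range m)
      (fun l => ENNReal.ofReal h * (Λ l ω * (X l ω + W l ω + r))) hp.le
    rw [Finset.card_range] at h1
    calc Z m ω ^ p ≤ κ * (A ω ^ p +
          (∑ l ∈ Finset.range m, ENNReal.ofReal h * (Λ l ω * (X l ω + W l ω + r))) ^ p) :=
          ENNReal.rpow_add_le_mul_rpow_add_rpow _ _ hp.le
      _ ≤ κ * (A ω ^ p + (m : ℝ≥0∞) ^ (p - 1) * ∑ l ∈ Finset.range m,
          (ENNReal.ofReal h * (Λ l ω * (X l ω + W l ω + r))) ^ p) := by gcongr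
      _ ≤ κ * (A ω ^ p + (N : ℝ≥0∞) ^ (p - 1) * ∑ l ∈ Finset.range m,
          ENNReal.ofReal (h ^ p) * (Λ l ω ^ p * (κ * κ * (X l ω ^ p + W l ω ^ p + r ^ p)))) := by
          gcongr with l _
          rw [ENNReal.mul_rpow_of_nonneg _ _ hp0.le, ENNReal.mul_rpow_of_nonneg _ _ hp0.le,
            ENNReal.ofReal_rpow_of_nonneg hh hp0.le]
          gcongr
          exact ENNReal.rpow_add_add_le hp _ _ _
      _ = _ := by
          have hN : (N : ℝ≥0∞) ^ (p - 1) = ENNReal.ofReal ((N : ℝ) ^ (p - 1)) := by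
            rw [← ENNReal.ofReal_rpow_of_nonneg (by positivity) (by linarith),
              ENNReal.ofReal_natCast]
          rw [ENNReal.ofReal_mul (by positivity), ← hN, mul_add, Finset.mul_sum, Finset.mul_sum]
          congr 1
          refine Finset.sum_congr rfl fun l _ => ?_
          ring
  -- Bounding `X l` by `Z l` closes the recursion; the contributions of `W` and `r` enter the
  -- initial constant.
  have hrec : ∀ m ≤ N, ∫⁻ ω, Z m ω ^ p ∂P ≤
      (κ * (κ * κ) * (∫⁻ ω, A ω ^ p ∂P
        + ENNReal.ofReal (∑ l ∈ Finset.range N, β l) * (w + r ^ p)))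
      + ∑ l ∈ Finset.range m, ENNReal.ofReal (8 ^ (p - 1) * β l) * ∫⁻ ω, Z l ω ^ p ∂P := by
    intro m hm
    have hmeas : ∀ l, Measurable fun ω => Λ l ω ^ p * (X l ω ^ p + W l ω ^ p + r ^ p) := fun l =>
      ((hΛ l).pow_const p).mul
        ((((hX l).pow_const p).add ((hW l).pow_const p)).add measurable_const)
    calc ∫⁻ ω, Z m ω ^ p ∂P ≤ ∫⁻ ω, (κ * A ω ^ p + ∑ l ∈ Finset.range m,
          κ * (κ * κ) * (ENNReal.ofReal (N ^ (p - 1) * h ^ p) *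
            (Λ l ω ^ p * (X l ω ^ p + W l ω ^ p + r ^ p)))) ∂P :=
          lintegral_mono (hZpow m hm)
      _ = κ * ∫⁻ ω, A ω ^ p ∂P + ∑ l ∈ Finset.range m,
          κ * (κ * κ) * (ENNReal.ofReal (N ^ (p - 1) * h ^ p) *
            ∫⁻ ω, Λ l ω ^ p * (X l ω ^ p + W l ω ^ p + r ^ p) ∂P) := by
          rw [lintegral_add_left ((hA.pow_const p).const_mul κ),
            lintegral_const_mul _ (hA.pow_const p),
            lintegral_finsetSum _ fun l _ => ((hmeas l).const_mul _).const_mul _]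
          congr 1
          refine Finset.sum_congr rfl fun l _ => ?_
          rw [lintegral_const_mul _ ((hmeas l).const_mul _), lintegral_const_mul _ (hmeas l)]
      _ ≤ κ * (κ * κ) * ∫⁻ ω, A ω ^ p ∂P + ∑ l ∈ Finset.range m,
          κ * (κ * κ) * (ENNReal.ofReal (β l) * (∫⁻ ω, Z l ω ^ p ∂P + (w + r ^ p))) := by
          refine add_le_add (mul_le_mul_left (le_mul_of_one_le_right' (one_le_mul hκ1 hκ1)) _)
            (Finset.sum_le_sum fun l hl => mul_le_mul_right ?_ _)
          · have hlN : l < N := (Finset.mem_range.1 hl).trans_le hm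
            calc ENNReal.ofReal (N ^ (p - 1) * h ^ p) *
                  ∫⁻ ω, Λ l ω ^ p * (X l ω ^ p + W l ω ^ p + r ^ p) ∂P
                ≤ ENNReal.ofReal (N ^ (p - 1) * h ^ p) *
                  ((∫⁻ ω, Λ l ω ^ p ∂P) * (∫⁻ ω, X l ω ^ p ∂P + (w + r ^ p))) := by
                  gcongr; exact hterm l hlN
              _ = ENNReal.ofReal (N ^ (p - 1) * h ^ p) *
                  (∫⁻ ω, Λ l ω ^ p ∂P) * (∫⁻ ω, X l ω ^ p ∂P + (w + r ^ p)) :=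
                  (mul_assoc _ _ _).symm
              _ ≤ ENNReal.ofReal (β l) * (∫⁻ ω, Z l ω ^ p ∂P + (w + r ^ p)) := by
                  refine mul_le_mul' (hΛβ l hlN) (add_le_add_left ?_ _)
                  refine lintegral_mono_ae ?_
                  filter_upwards [hle] with ω hω
                  exact ENNReal.rpow_le_rpow (hω l hlN.le) hp0.le
      _ = κ * (κ * κ) * ∫⁻ ω, A ω ^ p ∂P
          + κ * (κ * κ) * ((∑ l ∈ Finset.range m, ENNReal.ofReal (β l)) * (w + r ^ p))
          + ∑ l ∈ Finset.range m, ENNReal.ofReal (8 ^ (p - 1) * β l) * ∫⁻ ω, Z l ω ^ p ∂P := by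
          rw [add_assoc, Finset.sum_mul, Finset.mul_sum, ← Finset.sum_add_distrib]
          congr 1
          refine Finset.sum_congr rfl fun l _ => ?_
          rw [ENNReal.ofReal_mul (by positivity), h8]
          ring
      _ ≤ _ := by
          rw [ENNReal.ofReal_sum_of_nonneg fun l _ => hβ l, mul_add (κ * (κ * κ))]
          refine add_le_add_left (add_le_add_right (mul_le_mul_right (mul_le_mul_left ?_ _) _) _) _
          exact Finset.sum_le_sum_of_subset (Finset.range_mono hm)
  have hgron := ENNReal.le_mul_prod_of_le_add_sum hrec N le_rfl
  calc ∫⁻ ω, ((Finset.range (N + 1)).sup fun i => X i ω) ^ p ∂P ≤ ∫⁻ ω, Z N ω ^ p ∂P := by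
        refine lintegral_mono_ae ?_
        filter_upwards [hle] with ω hω
        refine ENNReal.rpow_le_rpow (Finset.sup_le fun i hi => ?_) hp0.le
        have hi' := Nat.lt_succ_iff.1 (Finset.mem_range.1 hi)
        exact (hω i hi').trans (hZmono hi' ω)
    _ ≤ _ := by
        refine hgron.trans ?_
        rw [h8, Finset.mul_sum]
        gcongr
        exact ENNReal.prod_one_add_ofReal_le (fun l => mul_nonneg (by positivity) (hβ l)) N

/-- Jensen's inequality for a concave power. It bounds the moment of the `α`-th power of the delayed
error by its `p`-th moment. -/
theorem lintegral_rpow_rpow_le {Ω : Type*} [MeasurableSpace Ω] {P : Measure Ω}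
    [IsProbabilityMeasure P] {X : Ω → ℝ≥0∞} (hX : Measurable X) {α : ℝ} (hα₀ : 0 < α)
    (hα₁ : α ≤ 1) : ∫⁻ ω, X ω ^ α ∂P ≤ (∫⁻ ω, X ω ∂P) ^ α := by
  have h := eLpNorm'_le_eLpNorm'_of_exponent_le (μ := P) hα₀ hα₁ hX.aestronglyMeasurable
  simp only [eLpNorm', enorm_eq_self, one_div, inv_one, ENNReal.rpow_one] at h
  rwa [ENNReal.rpow_inv_le_iff hα₀] at h

/-! ### Error recursion on one delay interval. -/

section Scheme

variable {d : ℕ}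
  {f : ℝ → EuclideanSpace ℝ (Fin d) → EuclideanSpace ℝ (Fin d) → EuclideanSpace ℝ (Fin d)}

/-- The indices of the random variables entering `eulerShifted … j k`. -/
def eulerPast (j k : ℕ) : Set (ℕ × ℕ) := {q | q.1 + 1 < j ∨ (q.1 + 1 = j ∧ q.2 < k)}

/-- Keeping the generating σ-algebra makes the values at step `k` of block `j + 1` independent of
the node variable `γ j k`, whose index `(j, k)` lies outside `eulerPast (j + 1) k`. -/
theorem measurable_eulerShifted {Ω : Type*}
    (hf : Measurable fun q : ℝ × EuclideanSpace ℝ (Fin d) × EuclideanSpace ℝ (Fin d) =>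
      f q.1 q.2.1 q.2.2)
    (τ : ℝ) (x₀ : EuclideanSpace ℝ (Fin d)) (N : ℕ) (γ : ℕ → ℕ → Ω → ℝ) (j k : ℕ) :
    Measurable[⨆ q ∈ eulerPast j k, (borel ℝ).comap (fun ω => γ q.1 q.2 ω)]
      fun ω => eulerShifted f τ x₀ N (fun j' k' => γ j' k' ω) j k := by
  have hmono : ∀ {j k j' k' : ℕ}, eulerPast j k ⊆ eulerPast j' k' →
      (⨆ q ∈ eulerPast j k, (borel ℝ).comap (fun ω : Ω => γ q.1 q.2 ω)) ≤
        ⨆ q ∈ eulerPast j' k', (borel ℝ).comap (fun ω : Ω => γ q.1 q.2 ω) := fun hsub =>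
    biSup_mono hsub
  induction j generalizing k with
  | zero => simp only [eulerShifted]; exact measurable_const
  | succ j ihj =>
    induction k with
    | zero =>
      simp only [eulerShifted, eulerBlock]
      refine (ihj N).mono (hmono fun q hq => ?_) le_rfl
      simp only [eulerPast, mem_ofPred_eq] at hq ⊢
      omega
    | succ k ihk =>
      have h1 := ihk.mono (hmono (j' := j + 1) (k' := k + 1) fun q hq => by
        simp only [eulerPast, mem_ofPred_eq] at hq ⊢; omega) le_rfl
      have h2 := (ihj k).mono (hmono (j' := j + 1) (k' := k + 1) fun q hq => by
        simp only [eulerPast, mem_ofPred_eq] at hq ⊢; omega) le_rfl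
      have h3 : Measurable[⨆ q ∈ eulerPast (j + 1) (k + 1),
          (borel ℝ).comap (fun ω : Ω => γ q.1 q.2 ω)] (γ j k) :=
        measurable_iSup_comap_of_mem (mβ := borel ℝ) (X := fun q : ℕ × ℕ => γ q.1 q.2) (i := (j, k))
          (by simp [eulerPast])
      have h4 : Measurable fun u : ℝ => j * τ + k * (τ / N) + τ / N * u := by fun_prop
      exact h1.add ((hf.comp ((h4.comp h3).prodMk (h1.prodMk h2))).const_smul (τ / N : ℝ))

/-- The error of the scheme with block index shifted by one. -/
noncomputable def shiftedError
    (f : ℝ → EuclideanSpace ℝ (Fin d) → EuclideanSpace ℝ (Fin d) → EuclideanSpace ℝ (Fin d))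
    (τ : ℝ) (x₀ : EuclideanSpace ℝ (Fin d)) (x : ℝ → EuclideanSpace ℝ (Fin d)) (N : ℕ)
    (u : ℕ → ℕ → ℝ) (j k : ℕ) : EuclideanSpace ℝ (Fin d) :=
  x ((j - 1) * τ + k * (τ / N)) - eulerShifted f τ x₀ N u j k

/-- Telescoping after inserting `h • F θ`: what remains compares `F` and `f` at the same time `θ`.
The initial term is the final error of the previous block. -/
theorem shiftedError_succ_eq {τ : ℝ} {x₀ : EuclideanSpace ℝ (Fin d)}
    {x : ℝ → EuclideanSpace ℝ (Fin d)} {N : ℕ} (hN : 0 < N) {j : ℕ} (u : ℕ → ℕ → ℝ)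
    {F : ℝ → EuclideanSpace ℝ (Fin d)}
    (hFTC : ∀ l < N, x (j * τ + (l + 1 : ℕ) * (τ / N)) - x (j * τ + l * (τ / N))
      = ∫ s in (j * τ + l * (τ / N))..(j * τ + l * (τ / N) + τ / N), F s) :
    ∀ i ≤ N, shiftedError f τ x₀ x N u (j + 1) i = shiftedError f τ x₀ x N u j N
      + ∑ l ∈ Finset.range i, quadratureError F (j * τ + l * (τ / N)) (τ / N) (u j l)
      + ∑ l ∈ Finset.range i, (τ / N) • (F (j * τ + l * (τ / N) + τ / N * u j l)
          - f (j * τ + l * (τ / N) + τ / N * u j l) (eulerShifted f τ x₀ N u (j + 1) l)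
            (eulerShifted f τ x₀ N u j l)) := by
  have hN' : (N : ℝ) ≠ 0 := by positivity
  intro i
  induction i with
  | zero =>
    intro _
    have : ((j : ℝ) - 1) * τ + N * (τ / N) = j * τ := by field_simp; ring
    simp [shiftedError, eulerShifted, eulerBlock, this]
  | succ i ih =>
    intro hi
    have h1 := ih (by omega)
    have h2 := hFTC i (by omega)
    rw [Finset.sum_range_succ, Finset.sum_range_succ]
    have h3 : shiftedError f τ x₀ x N u (j + 1) (i + 1) = shiftedError f τ x₀ x N u (j + 1) i
        + (∫ s in (j * τ + i * (τ / N))..(j * τ + i * (τ / N) + τ / N), F s)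
        - (τ / N) • f (j * τ + i * (τ / N) + τ / N * u j i) (eulerShifted f τ x₀ N u (j + 1) i)
            (eulerShifted f τ x₀ N u j i) := by
      rw [← h2]
      simp only [shiftedError, eulerShifted, eulerBlock, Nat.cast_add, Nat.cast_one,
        add_sub_cancel_right]
      abel
    rw [h3, h1, smul_sub, quadratureError]
    abel

/-- Subadditivity of `t ^ α` separates the oscillation of the solution from the delayed error. The
running maximum is taken up to `N` so that the free term does not depend on `i`. -/
theorem norm_shiftedError_succ_le {τ α r : ℝ} (hτ : 0 < τ) (hα₀ : 0 < α) (hα₁ : α ≤ 1)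
    {x₀ : EuclideanSpace ℝ (Fin d)}
    {x : ℝ → EuclideanSpace ℝ (Fin d)} {N : ℕ} (hN : 0 < N) {j : ℕ} {u : ℕ → ℕ → ℝ}
    (hu : ∀ l < N, u j l ∈ Icc (0 : ℝ) 1) {L : ℝ → ℝ} (hL : ∀ t, 0 ≤ L t)
    (hlip : ∀ t x₁ x₂ z₁ z₂, ‖f t x₁ z₁ - f t x₂ z₂‖ ≤ L t * (‖x₁ - x₂‖ + ‖z₁ - z₂‖ ^ α))
    (hFTC : ∀ l < N, x (j * τ + (l + 1 : ℕ) * (τ / N)) - x (j * τ + l * (τ / N))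
      = ∫ s in (j * τ + l * (τ / N))..(j * τ + l * (τ / N) + τ / N), f s (x s) (x (s - τ)))
    (hr : ∀ l < N, ∀ s ∈ Icc (j * τ + l * (τ / N)) (j * τ + l * (τ / N) + τ / N),
      ‖x s - x (j * τ + l * (τ / N))‖ + ‖x (s - τ) - x (j * τ + l * (τ / N) - τ)‖ ^ α ≤ r)
    {i : ℕ} (hi : i ≤ N) :
    ‖shiftedError f τ x₀ x N u (j + 1) i‖ ≤ ‖shiftedError f τ x₀ x N u j N‖
      + partialSups (fun i => ‖∑ l ∈ Finset.range i, quadratureError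
          (fun s => f s (x s) (x (s - τ))) (j * τ + l * (τ / N)) (τ / N) (u j l)‖) N
      + ∑ l ∈ Finset.range i, τ / N * (L (j * τ + l * (τ / N) + τ / N * u j l) *
          (‖shiftedError f τ x₀ x N u (j + 1) l‖ + ‖shiftedError f τ x₀ x N u j l‖ ^ α + r)) := by
  have hh : 0 < τ / N := div_pos hτ (by exact_mod_cast hN)
  rw [shiftedError_succ_eq hN u hFTC i hi]
  refine (norm_add₃_le).trans ?_
  gcongr
  · exact le_partialSups_of_le (fun i => ‖∑ l ∈ Finset.range i, quadratureError
          (fun s => f s (x s) (x (s - τ))) (j * τ + l * (τ / N)) (τ / N) (u j l)‖) hi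
  · refine (norm_sum_le _ _).trans (Finset.sum_le_sum fun l hl => ?_)
    have hlN : l < N := (Finset.mem_range.1 hl).trans_le hi
    set t := j * τ + l * (τ / N) with ht
    set θ := t + τ / N * u j l with hθ
    have hθmem : θ ∈ Icc t (t + τ / N) := by
      obtain ⟨h0, h1⟩ := hu l hlN
      constructor
      · rw [hθ]; linarith [mul_nonneg hh.le h0]
      · rw [hθ]; linarith [mul_le_of_le_one_right hh.le h1]
    have hr' := hr l hlN θ hθmem
    rw [norm_smul, Real.norm_of_nonneg hh.le]
    refine mul_le_mul_of_nonneg_left ((hlip _ _ _ _ _).trans ?_) hh.le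
    refine mul_le_mul_of_nonneg_left ?_ (hL θ)
    have e1 : shiftedError f τ x₀ x N u (j + 1) l = x t - eulerShifted f τ x₀ N u (j + 1) l := by
      simp only [shiftedError, Nat.cast_add, Nat.cast_one, add_sub_cancel_right, ht]
    have e2 : shiftedError f τ x₀ x N u j l = x (t - τ) - eulerShifted f τ x₀ N u j l := by
      rw [shiftedError, ht]; ring_nf
    have h1 : ‖x θ - eulerShifted f τ x₀ N u (j + 1) l‖ ≤
        ‖x θ - x t‖ + ‖shiftedError f τ x₀ x N u (j + 1) l‖ := by
      rw [e1]; exact norm_sub_le_norm_sub_add_norm_sub _ _ _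
    have h2 : ‖x (θ - τ) - eulerShifted f τ x₀ N u j l‖ ^ α ≤
        ‖x (θ - τ) - x (t - τ)‖ ^ α + ‖shiftedError f τ x₀ x N u j l‖ ^ α := by
      rw [e2]
      refine (Real.rpow_le_rpow (norm_nonneg _)
        (norm_sub_le_norm_sub_add_norm_sub _ (x (t - τ)) _) hα₀.le).trans ?_
      exact Real.rpow_add_le_add_rpow (norm_nonneg _) (norm_nonneg _) hα₀.le hα₁
    linarith

/-- Propagation of the `L^p` error over one delay interval. -/
theorem exists_lintegral_sup_shiftedError_le {Ω : Type*} [MeasurableSpace Ω] {P : Measure Ω}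
    [IsProbabilityMeasure P] {γ : ℕ → ℕ → Ω → ℝ} (hγ_meas : ∀ j k, Measurable (γ j k))
    (hγ_unif : ∀ j k, pdf.IsUniform (γ j k) (Icc (0 : ℝ) 1) P volume)
    (hγ_indep : iIndepFun (fun q : ℕ × ℕ => γ q.1 q.2) P)
    (hγ_mem : ∀ᵐ ω ∂P, ∀ j k, γ j k ω ∈ Icc (0 : ℝ) 1)
    {τ p α : ℝ} (hτ : 0 < τ) (hp : 2 ≤ p) (hα₀ : 0 < α) (hα₁ : α ≤ 1)
    (x₀ : EuclideanSpace ℝ (Fin d)) {x : ℝ → EuclideanSpace ℝ (Fin d)} (hx : Measurable x)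
    (hf : Measurable fun q : ℝ × EuclideanSpace ℝ (Fin d) × EuclideanSpace ℝ (Fin d) =>
      f q.1 q.2.1 q.2.2) {L : ℝ → ℝ} (hL : ∀ t, 0 ≤ L t) (hLm : Measurable L)
    (hLp : MemLp L (ENNReal.ofReal p) volume)
    (hlip : ∀ t x₁ x₂ z₁ z₂, ‖f t x₁ z₁ - f t x₂ z₂‖ ≤ L t * (‖x₁ - x₂‖ + ‖z₁ - z₂‖ ^ α))
    (hF : MemLp (fun s => f s (x s) (x (s - τ))) (ENNReal.ofReal p) volume) :
    ∃ C : ℝ, 0 ≤ C ∧ ∀ N : ℕ, 0 < N → ∀ (j : ℕ) (B r : ℝ), 0 ≤ B → 0 ≤ r →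
      (∀ l < N, x (j * τ + (l + 1 : ℕ) * (τ / N)) - x (j * τ + l * (τ / N))
        = ∫ s in (j * τ + l * (τ / N))..(j * τ + l * (τ / N) + τ / N), f s (x s) (x (s - τ))) →
      (∀ l < N, ∀ s ∈ Icc (j * τ + l * (τ / N)) (j * τ + l * (τ / N) + τ / N),
        ‖x s - x (j * τ + l * (τ / N))‖ + ‖x (s - τ) - x (j * τ + l * (τ / N) - τ)‖ ^ α ≤ r) →
      (∀ k ≤ N, ∫⁻ ω, ‖shiftedError f τ x₀ x N (fun j k => γ j k ω) j k‖ₑ ^ p ∂P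
        ≤ ENNReal.ofReal (B ^ p)) →
      ∫⁻ ω, ((Finset.range (N + 1)).sup
          fun i => ‖shiftedError f τ x₀ x N (fun j k => γ j k ω) (j + 1) i‖ₑ) ^ p ∂P
        ≤ ENNReal.ofReal (C * (B ^ p + (τ / N) ^ (p / 2) + (B ^ α) ^ p + r ^ p)) := by
  have hp0 : 0 < p := by linarith
  set F : ℝ → EuclideanSpace ℝ (Fin d) := fun s => f s (x s) (x (s - τ)) with hFdef
  have hFm : Measurable F := hf.comp (measurable_id.prodMk
    (hx.prodMk (hx.comp (measurable_id.sub_const τ))))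
  obtain ⟨Cq, hCq, hquad⟩ :=
    exists_lintegral_partialSups_quadratureError_le (E := EuclideanSpace ℝ (Fin d)) (P := P) hp
  have hq0 : ENNReal.ofReal p ≠ 0 := by simpa using hp0
  have hfin : ∀ {G : Type} [NormedAddCommGroup G] {g : ℝ → G},
      MemLp g (ENNReal.ofReal p) volume → ∫⁻ s, ‖g s‖ₑ ^ p ≠ ∞ := fun hg => by
    have := (lintegral_rpow_enorm_lt_top_of_eLpNorm_lt_top hq0 ENNReal.ofReal_ne_top hg.2).ne
    rwa [ENNReal.toReal_ofReal hp0.le] at this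
  set Φ : ℝ := (∫⁻ s, ‖F s‖ₑ ^ p).toReal with hΦ
  have hΦ0 : 0 ≤ Φ := ENNReal.toReal_nonneg
  have hΦ' : ∫⁻ s, ‖F s‖ₑ ^ p = ENNReal.ofReal Φ := (ENNReal.ofReal_toReal (hfin hF)).symm
  have hLfin : ∫⁻ s, ‖L s‖ₑ ^ p ≠ ∞ := hfin hLp
  set S : ℝ := τ ^ (p - 1) * (∫⁻ s, ‖L s‖ₑ ^ p).toReal with hS
  have hS0 : 0 ≤ S := by positivity
  refine ⟨8 ^ (p - 1) * (2 ^ (p - 1) + 2 ^ (p - 1) * (Cq * τ ^ (p / 2 - 1) * Φ) + S)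
    * Real.exp (8 ^ (p - 1) * S), by positivity, ?_⟩
  intro N hN j B r hB hr hFTC hmod hprev
  have hN' : (0 : ℝ) < N := Nat.cast_pos.2 hN
  set h : ℝ := τ / N with hhdef
  have hh : 0 < h := div_pos hτ hN'
  have hNh : N * h = τ := by rw [hhdef]; field_simp
  set e : ℕ → ℕ → Ω → EuclideanSpace ℝ (Fin d) :=
    fun j k ω => shiftedError f τ x₀ x N (fun j k => γ j k ω) j k with he
  have hem' : ∀ j k, Measurable[⨆ q ∈ eulerPast j k, (borel ℝ).comap (fun ω => γ q.1 q.2 ω)]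
      (e j k) := fun j k => measurable_const.sub (measurable_eulerShifted hf τ x₀ N γ j k)
  have hem : ∀ j k, Measurable (e j k) := fun j k =>
    (hem' j k).mono (iSup₂_le fun q _ => (hγ_meas q.1 q.2).comap_le) le_rfl
  set t : ℕ → ℝ := fun l => j * τ + l * h with ht
  -- Values computed before step `l` of this block do not involve the node `γ j l` used in that
  -- step.
  have hindep : ∀ l (G : Ω → EuclideanSpace ℝ (Fin d)),
      Measurable[⨆ q ∈ eulerPast (j + 1) l, (borel ℝ).comap (fun ω => γ q.1 q.2 ω)] G →
      IndepFun G (γ j l) P := fun l G hG => by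
    refine iIndepFun.indepFun_of_measurable_iSup hγ_indep (fun q => hγ_meas q.1 q.2)
      (S := eulerPast (j + 1) l) (T := {(j, l)}) (by simp [eulerPast]) ?_
      (measurable_iSup_comap_of_mem (X := fun q : ℕ × ℕ => γ q.1 q.2) (mem_singleton (j, l)))
    simpa only [← BorelSpace.measurable_eq (α := ℝ)] using hG
  have hindep' : ∀ l, IndepFun (e j l) (γ j l) P := fun l =>
    hindep l _ ((hem' j l).mono (biSup_mono fun q hq => by
      simp only [eulerPast, mem_ofPred_eq] at hq ⊢; omega) le_rfl)
  set Λ : ℕ → Ω → ℝ≥0∞ := fun l ω => ENNReal.ofReal (L (t l + h * γ j l ω)) with hΛ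
  have hΛfun : ∀ l, Measurable fun u : ℝ => ENNReal.ofReal (L (t l + h * u)) := fun l =>
    (hLm.comp (by fun_prop)).ennreal_ofReal
  set Q : Ω → ℝ := fun ω => partialSups (fun i => ‖∑ l ∈ Finset.range i,
    quadratureError F (t l) h (γ j l ω)‖) N with hQ
  have hQ0 : ∀ ω, 0 ≤ Q ω := fun ω => (norm_nonneg _).trans
    (le_partialSups_of_le (fun i => ‖∑ l ∈ Finset.range i,
      quadratureError F (t l) h (γ j l ω)‖) (Nat.zero_le N))
  have hQm : Measurable Q := measurable_partialSups fun i _ =>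
    (Finset.measurable_sum _ fun l _ =>
      (measurable_quadratureError hFm (t l) h).comp (hγ_meas j l)).norm
  -- `N ^ (p - 1) * h ^ p` from Hölder times the density `h⁻¹` is `τ ^ (p - 1)`, so these
  -- coefficients sum to at most `S`, whatever `N` is.
  set β : ℕ → ℝ := fun l =>
    τ ^ (p - 1) * (∫⁻ s in Icc (t l) (t l + h), ‖L s‖ₑ ^ p).toReal with hβ
  have hβ0 : ∀ l, 0 ≤ β l := fun l => by positivity
  have hLI : ∀ l, ∫⁻ s in Icc (t l) (t l + h), ‖L s‖ₑ ^ p ≠ ∞ := fun l =>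
    ((setLIntegral_le_lintegral _ _).trans_lt hLfin.lt_top).ne
  have hβS : ∑ l ∈ Finset.range N, β l ≤ S := by
    rw [hβ, ← Finset.mul_sum, ← ENNReal.toReal_sum fun l _ => hLI l]
    refine mul_le_mul_of_nonneg_left (ENNReal.toReal_mono hLfin ?_) (by positivity)
    exact sum_setLIntegral_Icc_le _ _ hh.le N
  have hmain := lintegral_sup_rpow_le_of_le_add_sum (P := P) (by linarith : 1 < p) (N := N) hh.le
    (X := fun l ω => ‖e (j + 1) l ω‖ₑ) (W := fun l ω => ‖e j l ω‖ₑ ^ α) (Λ := Λ)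
    (A := fun ω => ‖e j N ω‖ₑ + ENNReal.ofReal (Q ω)) (r := ENNReal.ofReal r)
    (w := ENNReal.ofReal ((B ^ α) ^ p)) hβ0 (fun l => (hem _ l).enorm)
    (fun l => (hem _ l).enorm.pow_const α) (fun l => (hΛfun l).comp (hγ_meas j l))
    ((hem j N).enorm.add hQm.ennreal_ofReal) ?_ ?_ ?_ ?_ ?_
  · refine hmain.trans ?_
    have hA : ∫⁻ ω, (‖e j N ω‖ₑ + ENNReal.ofReal (Q ω)) ^ p ∂P ≤ ENNReal.ofReal
        (2 ^ (p - 1) * (B ^ p + Cq * τ ^ (p / 2 - 1) * h ^ (p / 2) * Φ)) := by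
      calc ∫⁻ ω, (‖e j N ω‖ₑ + ENNReal.ofReal (Q ω)) ^ p ∂P
          ≤ ∫⁻ ω, 2 ^ (p - 1) * (‖e j N ω‖ₑ ^ p + ENNReal.ofReal (Q ω) ^ p) ∂P :=
            lintegral_mono fun ω => ENNReal.rpow_add_le_mul_rpow_add_rpow _ _ (by linarith)
        _ = 2 ^ (p - 1) * (∫⁻ ω, ‖e j N ω‖ₑ ^ p ∂P + ∫⁻ ω, ENNReal.ofReal (Q ω) ^ p ∂P) := by
            have m1 : Measurable fun ω => ‖e j N ω‖ₑ ^ p := (hem j N).enorm.pow_const p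
            have m2 : Measurable fun ω => ENNReal.ofReal (Q ω) ^ p :=
              hQm.ennreal_ofReal.pow_const p
            have m3 : Measurable fun ω => ‖e j N ω‖ₑ ^ p + ENNReal.ofReal (Q ω) ^ p := m1.add m2
            rw [lintegral_const_mul _ m3, lintegral_add_left m1]
        _ ≤ ENNReal.ofReal (2 ^ (p - 1)) * (ENNReal.ofReal (B ^ p) +
            ENNReal.ofReal (Cq * τ ^ (p / 2 - 1) * h ^ (p / 2)) * ENNReal.ofReal Φ) := by
            rw [ENNReal.ofReal_two_rpow, ← hΦ']
            gcongr
            · exact hprev N le_rfl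
            · have := hquad F hFm hF (γ j) (hγ_meas j) (hγ_unif j)
                (hγ_indep.precomp (g := fun k : ℕ => (j, k)) (fun a b hab => by simpa using hab))
                (j * τ) h hh N hN
              rwa [hNh] at this
        _ = _ := by
            rw [← ENNReal.ofReal_mul (by positivity),
              ← ENNReal.ofReal_add (by positivity) (by positivity),
              ← ENNReal.ofReal_mul (by positivity)]
    rw [ENNReal.ofReal_rpow_of_nonneg hr hp0.le, ← ENNReal.ofReal_add (by positivity) (by positivity),
      ← ENNReal.ofReal_mul (Finset.sum_nonneg fun l _ => hβ0 l)]
    calc _ ≤ ENNReal.ofReal (8 ^ (p - 1)) * (ENNReal.ofReal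
          (2 ^ (p - 1) * (B ^ p + Cq * τ ^ (p / 2 - 1) * h ^ (p / 2) * Φ)) +
          ENNReal.ofReal (S * ((B ^ α) ^ p + r ^ p))) *
          ENNReal.ofReal (Real.exp (8 ^ (p - 1) * S)) := by
          gcongr
      _ = ENNReal.ofReal (8 ^ (p - 1) *
          (2 ^ (p - 1) * (B ^ p + Cq * τ ^ (p / 2 - 1) * h ^ (p / 2) * Φ) +
          S * ((B ^ α) ^ p + r ^ p)) * Real.exp (8 ^ (p - 1) * S)) := by
          rw [← ENNReal.ofReal_add (by positivity) (by positivity),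
            ← ENNReal.ofReal_mul (by positivity), ← ENNReal.ofReal_mul (by positivity)]
      _ ≤ _ := by
          refine ENNReal.ofReal_le_ofReal ?_
          -- A sum of products is enlarged to a product of sums, so that one constant multiplies all
          -- contributions.
          have hcore : ∀ {a c b η v : ℝ}, 0 ≤ a → 0 ≤ c → 0 ≤ b → 0 ≤ η → 0 ≤ v →
              a * (b + c * η) + S * v ≤ (a + a * c + S) * (b + η + v) := by
            intro a c b η v ha hc hb hη hv
            have : 0 ≤ a * (η + v) + a * c * (b + v) + S * (b + η) := by positivity
            linarith
          have h1 := hcore (a := 2 ^ (p - 1)) (c := Cq * τ ^ (p / 2 - 1) * Φ) (b := B ^ p)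
            (η := h ^ (p / 2)) (v := (B ^ α) ^ p + r ^ p) (by positivity) (by positivity)
            (by positivity) (by positivity) (by positivity)
          have h2 : 0 ≤ (8 : ℝ) ^ (p - 1) * Real.exp (8 ^ (p - 1) * S) := by positivity
          have h3 := mul_le_mul_of_nonneg_left h1 h2
          refine (le_of_eq ?_).trans (h3.trans (le_of_eq ?_)) <;> ring
  · filter_upwards [hγ_mem] with ω hω i hi
    have hb := norm_shiftedError_succ_le (x₀ := x₀) hτ hα₀ hα₁ hN
      (u := fun j k => γ j k ω) (fun l _ => hω j l) hL hlip hFTC hmod hi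
    have hb' := ENNReal.ofReal_le_ofReal hb
    refine (ofReal_norm (e (j + 1) i ω)).symm.le.trans (hb'.trans (le_of_eq ?_))
    have hnn : ∀ l, 0 ≤ ‖e (j + 1) l ω‖ + ‖e j l ω‖ ^ α + r := fun l => by positivity
    rw [ENNReal.ofReal_add (add_nonneg (norm_nonneg _) (hQ0 ω)) (Finset.sum_nonneg fun l _ =>
        mul_nonneg hh.le (mul_nonneg (hL _) (hnn l))),
      ENNReal.ofReal_add (norm_nonneg _) (hQ0 ω), ofReal_norm,
      ENNReal.ofReal_sum_of_nonneg fun l _ => mul_nonneg hh.le (mul_nonneg (hL _) (hnn l))]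
    congr 1
    refine Finset.sum_congr rfl fun l _ => ?_
    rw [ENNReal.ofReal_mul hh.le, ENNReal.ofReal_mul (hL _),
      ENNReal.ofReal_add (by positivity) hr, ENNReal.ofReal_add (by positivity) (by positivity),
      ofReal_norm, ← ENNReal.ofReal_rpow_of_nonneg (norm_nonneg _) hα₀.le, ofReal_norm]
  · exact fun l _ => (hindep l _ (hem' (j + 1) l)).comp measurable_enorm (hΛfun l)
  · exact fun l _ => (hindep' l).comp (measurable_enorm.pow_const α) (hΛfun l)
  · intro l _
    have h1 : ∫⁻ ω, Λ l ω ^ p ∂P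
        = ENNReal.ofReal h⁻¹ * ∫⁻ s in Icc (t l) (t l + h), ‖L s‖ₑ ^ p := by
      rw [← lintegral_comp_uniform (hγ_meas j l) (hγ_unif j l) (t l) hh (hLm.enorm.pow_const p)]
      refine lintegral_congr fun ω => ?_
      rw [hΛ, Real.enorm_of_nonneg (hL _)]
    simp only [hβ]
    rw [h1, ← mul_assoc, ← ENNReal.ofReal_mul (by positivity),
      ENNReal.ofReal_mul (p := τ ^ (p - 1)) (by positivity), ENNReal.ofReal_toReal (hLI l)]
    refine le_of_eq ?_
    congr 2
    rw [← hNh, Real.mul_rpow hN'.le hh.le, Real.rpow_sub_one hh.ne']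
    ring
  · intro l hl
    have h1 : ∀ ω, (‖e j l ω‖ₑ ^ α) ^ p = (‖e j l ω‖ₑ ^ p) ^ α := fun ω => by
      rw [← ENNReal.rpow_mul, ← ENNReal.rpow_mul, mul_comm]
    rw [lintegral_congr h1]
    refine (lintegral_rpow_rpow_le ((hem j l).enorm.pow_const p) hα₀ hα₁).trans ?_
    refine (ENNReal.rpow_le_rpow (hprev l hl.le) hα₀.le).trans (le_of_eq ?_)
    rw [ENNReal.ofReal_rpow_of_nonneg (by positivity) hα₀.le, ← Real.rpow_mul hB,
      ← Real.rpow_mul hB, mul_comm]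

end Scheme

/-! ### Convergence rate by induction on the delay intervals. -/

/-- All contributions are absorbed into the common rate `η`. The outer `+ 1` keeps the new constant
positive even when `c = 0`. -/
theorem mul_sum_rpow_le_rpow {p c B h B' r b b' s η : ℝ} (hp : 0 < p) (hc : 0 ≤ c) (hB : 0 ≤ B)
    (hh : 0 ≤ h) (hB' : 0 ≤ B') (hr : 0 ≤ r) (hb : 0 ≤ b) (hb' : 0 ≤ b') (hs : 0 ≤ s)
    (hη : 0 ≤ η) (h1 : B ≤ b * η) (h2 : h ^ (1 / 2 : ℝ) ≤ η) (h3 : B' ≤ b' * η)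
    (h4 : r ≤ s * η) :
    c * (B ^ p + h ^ (p / 2) + B' ^ p + r ^ p)
      ≤ ((c * (b ^ p + 1 + b' ^ p + s ^ p) + 1) ^ (1 / p) * η) ^ p := by
  have hhp : h ^ (p / 2) = (h ^ (1 / 2 : ℝ)) ^ p := by
    rw [← Real.rpow_mul hh]; ring_nf
  rw [Real.mul_rpow (by positivity) hη, ← Real.rpow_mul (by positivity), one_div,
    inv_mul_cancel₀ hp.ne', Real.rpow_one, hhp]
  have e1 : B ^ p ≤ b ^ p * η ^ p := by
    rw [← Real.mul_rpow hb hη]; exact Real.rpow_le_rpow hB h1 hp.le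
  have e2 : (h ^ (1 / 2 : ℝ)) ^ p ≤ η ^ p := Real.rpow_le_rpow (by positivity) h2 hp.le
  have e3 : B' ^ p ≤ b' ^ p * η ^ p := by
    rw [← Real.mul_rpow hb' hη]; exact Real.rpow_le_rpow hB' h3 hp.le
  have e4 : r ^ p ≤ s ^ p * η ^ p := by
    rw [← Real.mul_rpow hs hη]; exact Real.rpow_le_rpow hr h4 hp.le
  have e5 : 0 ≤ η ^ p := by positivity
  calc c * (B ^ p + (h ^ (1 / 2 : ℝ)) ^ p + B' ^ p + r ^ p)
      ≤ c * (b ^ p * η ^ p + η ^ p + b' ^ p * η ^ p + s ^ p * η ^ p) := by gcongr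
    _ ≤ c * (b ^ p * η ^ p + η ^ p + b' ^ p * η ^ p + s ^ p * η ^ p) + η ^ p := by linarith
    _ = _ := by ring

/-- The bound `τ / N ≤ 1` lets the smallest exponent dominate all powers of the step. -/
theorem step_pos_and_le_one {τ : ℝ} (hτ : 0 < τ) {N : ℕ} (hN : ⌈τ⌉₊ ≤ N) :
    0 < N ∧ 0 < τ / N ∧ τ / N ≤ 1 := by
  have h1 : 0 < N := (Nat.ceil_pos.2 hτ).trans_le hN
  have h2 : (0 : ℝ) < N := Nat.cast_pos.2 h1
  exact ⟨h1, div_pos hτ h2, (div_le_one h2).2 (Nat.ceil_le.1 hN)⟩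

/-- Convergence of the randomized Euler scheme for globally measurable right-hand sides. -/
theorem exists_lintegral_sup_shiftedError_le_rate {d : ℕ}
    {f : ℝ → EuclideanSpace ℝ (Fin d) → EuclideanSpace ℝ (Fin d) → EuclideanSpace ℝ (Fin d)}
    {Ω : Type*} [MeasurableSpace Ω] {P : Measure Ω}
    [IsProbabilityMeasure P] {γ : ℕ → ℕ → Ω → ℝ} (hγ_meas : ∀ j k, Measurable (γ j k))
    (hγ_unif : ∀ j k, pdf.IsUniform (γ j k) (Icc (0 : ℝ) 1) P volume)
    (hγ_indep : iIndepFun (fun q : ℕ × ℕ => γ q.1 q.2) P)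
    (hγ_mem : ∀ᵐ ω ∂P, ∀ j k, γ j k ω ∈ Icc (0 : ℝ) 1)
    {τ p α : ℝ} (hτ : 0 < τ) (hp : 2 ≤ p) (hα₀ : 0 < α) (hα₁ : α ≤ 1)
    (x₀ : EuclideanSpace ℝ (Fin d)) {x : ℝ → EuclideanSpace ℝ (Fin d)} (hx : Measurable x)
    (hf : Measurable fun q : ℝ × EuclideanSpace ℝ (Fin d) × EuclideanSpace ℝ (Fin d) =>
      f q.1 q.2.1 q.2.2) {L : ℝ → ℝ} (hL : ∀ t, 0 ≤ L t) (hLm : Measurable L)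
    (hLp : MemLp L (ENNReal.ofReal p) volume)
    (hlip : ∀ t x₁ x₂ z₁ z₂, ‖f t x₁ z₁ - f t x₂ z₂‖ ≤ L t * (‖x₁ - x₂‖ + ‖z₁ - z₂‖ ^ α))
    (hF : MemLp (fun s => f s (x s) (x (s - τ))) (ENNReal.ofReal p) volume)
    (n : ℕ) (hinit : ∀ t ≤ 0, x t = x₀)
    (hFTC : ∀ s t, 0 ≤ s → s ≤ t → t ≤ (n + 1) * τ →
      x t - x s = ∫ u in s..t, f u (x u) (x (u - τ)))
    {K : ℝ} (hK : 0 ≤ K) (hmod : ∀ s t, 0 ≤ s → s ≤ t → t ≤ (n + 1) * τ →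
      ‖x t - x s‖ ≤ K * (t - s) ^ (1 / 2 : ℝ)) :
    ∀ j ≤ n, ∃ C : ℝ, 0 < C ∧ ∀ N : ℕ, ⌈τ⌉₊ ≤ N →
      ∫⁻ ω, ((Finset.range (N + 1)).sup
          fun i => ‖shiftedError f τ x₀ x N (fun j k => γ j k ω) (j + 1) i‖ₑ) ^ p ∂P
        ≤ ENNReal.ofReal ((C * (τ / N) ^ (α ^ j / 2)) ^ p) := by
  have hp0 : 0 < p := by linarith
  obtain ⟨c, hc, hblock⟩ := exists_lintegral_sup_shiftedError_le hγ_meas hγ_unif hγ_indep hγ_mem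
    hτ hp hα₀ hα₁ x₀ hx hf hL hLm hLp hlip hF
  have hgrid : ∀ {N j l : ℕ}, 0 < N → j ≤ n → l < N →
      0 ≤ j * τ + l * (τ / N) ∧ j * τ + l * (τ / N) + τ / N ≤ (j + 1) * τ ∧
        (j + 1) * τ ≤ (n + 1) * τ := by
    intro N j l hN hj hl
    have hN' : (0 : ℝ) < N := Nat.cast_pos.2 hN
    have hh : 0 < τ / N := div_pos hτ hN'
    refine ⟨by positivity, ?_, ?_⟩
    · have h1 : ((l : ℝ) + 1) * (τ / N) ≤ N * (τ / N) := by
        gcongr; exact_mod_cast hl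
      have h2 : N * (τ / N) = τ := by field_simp
      linarith
    · gcongr
  have hFTC' : ∀ {N j : ℕ}, 0 < N → j ≤ n → ∀ l < N,
      x (j * τ + (l + 1 : ℕ) * (τ / N)) - x (j * τ + l * (τ / N))
        = ∫ s in (j * τ + l * (τ / N))..(j * τ + l * (τ / N) + τ / N),
          f s (x s) (x (s - τ)) := by
    intro N j hN hj l hl
    obtain ⟨h1, h2, h3⟩ := hgrid hN hj hl
    have hh : 0 < τ / N := div_pos hτ (Nat.cast_pos.2 hN)
    rw [← hFTC _ _ h1 (by linarith) (h2.trans h3)]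
    push_cast
    ring_nf
  have hmod' : ∀ {h s t : ℝ}, 0 ≤ s → s ≤ t → t ≤ s + h → t ≤ (n + 1) * τ →
      ‖x t - x s‖ ≤ K * h ^ (1 / 2 : ℝ) := by
    intro h s t h1 h2 h3 h4
    refine (hmod s t h1 h2 h4).trans (mul_le_mul_of_nonneg_left ?_ hK)
    exact Real.rpow_le_rpow (by linarith) (by linarith) (by norm_num)
  intro j
  induction j with
  | zero =>
    intro _
    refine ⟨(c * (0 ^ p + 1 + 0 ^ p + K ^ p) + 1) ^ (1 / p), by positivity, fun N hN => ?_⟩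
    obtain ⟨hN0, hh, hh1⟩ := step_pos_and_le_one hτ hN
    refine (hblock N hN0 0 0 (K * (τ / N) ^ (1 / 2 : ℝ)) le_rfl (by positivity)
      (hFTC' hN0 (Nat.zero_le n)) ?_ ?_).trans (ENNReal.ofReal_le_ofReal ?_)
    · intro l hl s hs
      obtain ⟨h1, h2, h3⟩ := hgrid hN0 (Nat.zero_le n) hl
      simp only [Nat.cast_zero, zero_mul, zero_add] at h1 h2 h3 hs ⊢
      -- On the first interval both delayed times lie in the constant history, so no `h ^ (α / 2)`
      -- appears.
      rw [hinit (s - τ) (by linarith [hs.2]), hinit (l * (τ / N) - τ) (by linarith), sub_self,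
        norm_zero, Real.zero_rpow hα₀.ne', add_zero]
      exact hmod' h1 hs.1 hs.2 (by linarith [hs.2])
    · intro k hk
      have hk' : (k : ℝ) * (τ / N) ≤ N * (τ / N) := by gcongr
      have h2 : N * (τ / N) = τ := by field_simp
      have h3 : ∀ ω, shiftedError f τ x₀ x N (fun j k => γ j k ω) 0 k = 0 := fun ω => by
        simp only [shiftedError, eulerShifted, Nat.cast_zero]
        rw [hinit _ (by linarith), sub_self]
      simp [h3, ENNReal.zero_rpow_of_pos hp0]
    · have hz : (0 : ℝ) ^ α = 0 := Real.zero_rpow hα₀.ne'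
      refine mul_sum_rpow_le_rpow hp0 hc le_rfl hh.le (by positivity) (by positivity) le_rfl le_rfl
        hK (by positivity) (by simp) (by simp) (by simp [hz]) (by simp)
  | succ j ih =>
    intro hj
    obtain ⟨C, hC, hCN⟩ := ih (by omega)
    -- The four entries come from the inherited error, the quadrature, the delayed error and the
    -- oscillation of the solution.
    refine ⟨(c * (C ^ p + 1 + (C ^ α) ^ p + (K + K ^ α) ^ p) + 1) ^ (1 / p), by positivity,
      fun N hN => ?_⟩
    obtain ⟨hN0, hh, hh1⟩ := step_pos_and_le_one hτ hN
    have hexp : ∀ {a b : ℝ}, b ≤ a → (τ / N) ^ a ≤ (τ / N) ^ b := fun hab =>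
      Real.rpow_le_rpow_of_exponent_ge hh hh1 hab
    have hαj : α ^ j ≤ 1 := pow_le_one₀ hα₀.le hα₁
    have hαj' : α ^ (j + 1) ≤ α ^ j := pow_le_pow_of_le_one hα₀.le hα₁ (Nat.le_succ j)
    have hαj'' : α ^ (j + 1) ≤ α := by
      rw [pow_succ]; exact mul_le_of_le_one_left hα₀.le hαj
    have hKα : (K * (τ / N) ^ (1 / 2 : ℝ)) ^ α = K ^ α * (τ / N) ^ (α / 2) := by
      rw [Real.mul_rpow hK (by positivity), ← Real.rpow_mul hh.le]; ring_nf
    refine (hblock N hN0 (j + 1) (C * (τ / N) ^ (α ^ j / 2))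
      (K * (τ / N) ^ (1 / 2 : ℝ) + K ^ α * (τ / N) ^ (α / 2)) (by positivity) (by positivity)
      (hFTC' hN0 hj) ?_ ?_).trans (ENNReal.ofReal_le_ofReal ?_)
    · intro l hl s hs
      obtain ⟨h1, h2, h3⟩ := hgrid hN0 hj hl
      have h4 : (0 : ℝ) ≤ ((j + 1 : ℕ) : ℝ) * τ + l * (τ / N) - τ := by
        push_cast
        have : (0 : ℝ) ≤ j * τ + l * (τ / N) := by positivity
        linarith
      refine add_le_add (hmod' h1 hs.1 hs.2 (by linarith [hs.2])) ?_
      rw [← hKα]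
      exact Real.rpow_le_rpow (norm_nonneg _) (hmod' h4 (by linarith [hs.1]) (by linarith [hs.2])
        (by linarith [hs.2])) hα₀.le
    · intro k hk
      refine (lintegral_mono fun ω => ENNReal.rpow_le_rpow ?_ hp0.le).trans (hCN N hN)
      exact Finset.le_sup (f := fun i =>
        ‖shiftedError f τ x₀ x N (fun j k => γ j k ω) (j + 1) i‖ₑ)
        (Finset.mem_range.2 (Nat.lt_succ_of_le hk))
    · refine mul_sum_rpow_le_rpow hp0 hc (by positivity) hh.le (by positivity) (by positivity)
        hC.le (by positivity) (by positivity) (by positivity) ?_ (hexp (by linarith)) ?_ ?_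
      · exact mul_le_mul_of_nonneg_left (hexp (by linarith)) hC.le
      -- The delayed error has exactly the new exponent `α ^ (j + 1) / 2`; every other contribution
      -- has an exponent at least as large.
      · rw [Real.mul_rpow hC.le (by positivity), ← Real.rpow_mul hh.le]
        refine le_of_eq ?_
        congr 2
        ring
      · rw [add_mul]
        exact add_le_add (mul_le_mul_of_nonneg_left (hexp (by linarith)) hK)
          (mul_le_mul_of_nonneg_left (hexp (by linarith)) (by positivity))

/-! ### Regularity of the solution and regularization of the right-hand side. -/

/-- Fundamental theorem of calculus for absolutely continuous curves in `ℝ^d`. -/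
theorem AbsolutelyContinuousOnInterval.sub_eq_integral_of_ae_hasDerivAt {d : ℕ} {a b : ℝ}
    {x F : ℝ → EuclideanSpace ℝ (Fin d)} (hx : AbsolutelyContinuousOnInterval x a b)
    (hab : a ≤ b) (hF : IntervalIntegrable F volume a b)
    (hd : ∀ᵐ t ∂(volume.restrict (Icc a b)), HasDerivAt x (F t) t) :
    x b - x a = ∫ t in a..b, F t := by
  ext i
  -- Coordinates are 1-Lipschitz, which reduces the claim to the scalar theorem.
  have hac : AbsolutelyContinuousOnInterval (fun t => x t i) a b := by
    refine squeeze_zero (fun E => Finset.sum_nonneg fun i _ => dist_nonneg)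
      (fun E => Finset.sum_le_sum fun k _ => ?_) hx
    rw [dist_eq_norm, dist_eq_norm]
    exact PiLp.norm_apply_le (x (E.2 k).1 - x (E.2 k).2) i
  have h1 : (∫ t in a..b, F t) i = ∫ t in a..b, F t i :=
    ((EuclideanSpace.proj (𝕜 := ℝ) i).intervalIntegral_comp_comm hF).symm
  rw [h1, PiLp.sub_apply, ← hac.integral_deriv_eq_sub]
  refine intervalIntegral.integral_congr_ae ?_
  rw [uIoc_of_le hab]
  have hd' := (ae_restrict_iff' measurableSet_Icc).1 hd
  filter_upwards [hd'] with t ht hmem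
  exact ((EuclideanSpace.proj (𝕜 := ℝ) i).hasFDerivAt.comp_hasDerivAt t
    (ht (Ioc_subset_Icc_self hmem))).deriv

/-- Cauchy–Schwarz, since `2 ≤ p` on a bounded interval. The exponent 1/2 matches the quadrature
rate, so a better one would not help. -/
theorem exists_norm_intervalIntegral_le_sqrt {E : Type*} [NormedAddCommGroup E] [NormedSpace ℝ E]
    {p : ℝ} (hp : 2 ≤ p) {F : ℝ → E} (hF : MemLp F (ENNReal.ofReal p) volume) (T : ℝ) :
    ∃ K : ℝ, 0 ≤ K ∧ ∀ s t, 0 ≤ s → s ≤ t → t ≤ T →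
      ‖∫ u in s..t, F u‖ ≤ K * (t - s) ^ (1 / 2 : ℝ) := by
  have h2 : MemLp F 2 (volume.restrict (Icc 0 T)) := by
    refine (hF.restrict _).mono_exponent ?_
    rw [show (2 : ℝ≥0∞) = ENNReal.ofReal 2 by simp]
    exact ENNReal.ofReal_le_ofReal hp
  refine ⟨(eLpNorm F 2 (volume.restrict (Icc 0 T))).toReal, ENNReal.toReal_nonneg,
    fun s t hs hst ht => ?_⟩
  have hsub : Ioc s t ⊆ Icc 0 T := fun u hu => ⟨hs.trans hu.1.le, hu.2.trans ht⟩
  have hle : volume.restrict (Ioc s t) ≤ volume.restrict (Icc 0 T) :=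
    Measure.restrict_mono hsub le_rfl
  have h3 : ‖∫ u in s..t, F u‖ₑ
      ≤ eLpNorm F 2 (volume.restrict (Icc 0 T)) * ENNReal.ofReal (t - s) ^ (1 / 2 : ℝ) := by
    rw [intervalIntegral.integral_of_le hst]
    refine (enorm_integral_le_lintegral_enorm _).trans ?_
    rw [← eLpNorm_one_eq_lintegral_enorm]
    refine (eLpNorm_le_eLpNorm_mul_rpow_measure_univ (q := 2) one_le_two
      (h2.1.mono_measure hle)).trans ?_
    have he : 1 / (1 : ℝ≥0∞).toReal - 1 / (2 : ℝ≥0∞).toReal = 1 / 2 := by norm_num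
    rw [he, Measure.restrict_apply_univ, Real.volume_Ioc]
    gcongr
  rw [← ofReal_norm, ← ENNReal.ofReal_toReal h2.2.ne, ENNReal.ofReal_rpow_of_nonneg
    (by linarith) (by norm_num), ← ENNReal.ofReal_mul ENNReal.toReal_nonneg] at h3
  exact (ENNReal.ofReal_le_ofReal_iff (mul_nonneg ENNReal.toReal_nonneg
    (Real.rpow_nonneg (by linarith) _))).1 h3

/-- After modification on a null set of times, the right-hand side is jointly measurable and
satisfies its growth and Lipschitz–Hölder bounds at all times, with measurable weights. -/
theorem LipHolderRHS.exists_regularization {d : ℕ}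
    {f : ℝ → EuclideanSpace ℝ (Fin d) → EuclideanSpace ℝ (Fin d) → EuclideanSpace ℝ (Fin d)}
    {T p α : ℝ} (hf : LipHolderRHS f T p α) :
    ∃ (g : ℝ → EuclideanSpace ℝ (Fin d) → EuclideanSpace ℝ (Fin d) → EuclideanSpace ℝ (Fin d))
      (K L : ℝ → ℝ) (A : Set ℝ), MeasurableSet A ∧ volume (Icc 0 T \ A) = 0 ∧
      (∀ t ∈ A, g t = f t) ∧
      Measurable (fun q : ℝ × EuclideanSpace ℝ (Fin d) × EuclideanSpace ℝ (Fin d) =>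
        g q.1 q.2.1 q.2.2) ∧
      (∀ t, 0 ≤ L t) ∧ Measurable L ∧ MemLp K (ENNReal.ofReal p) volume ∧
      MemLp L (ENNReal.ofReal p) volume ∧ (∀ t, ‖g t 0 0‖ ≤ K t) ∧
      ∀ t x₁ x₂ z₁ z₂, ‖g t x₁ z₁ - g t x₂ z₂‖ ≤ L t * (‖x₁ - x₂‖ + ‖z₁ - z₂‖ ^ α) := by
  classical
  obtain ⟨K, L, hK0, hL0, hKp, hLp, hK, hL⟩ := hf.exists_weights
  set Km := hKp.1.mk K with hKm
  set Lm := hLp.1.mk L with hLm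
  obtain ⟨B, hB, hBm, hBeq⟩ :=
    (hKp.1.ae_eq_mk.and hLp.1.ae_eq_mk).exists_measurable_mem
  replace hBeq : ∀ t ∈ B, K t = Km t ∧ L t = Lm t := hBeq
  -- The times in `[0, T]` at which both weights equal their measurable representatives; off this
  -- set everything is replaced by zero.
  set A := B ∩ Icc 0 T with hA
  have hAm : MeasurableSet A := hBm.inter measurableSet_Icc
  have hLpm : ∀ {G : ℝ → ℝ} (hG : MemLp G (ENNReal.ofReal p) (volume.restrict (Icc 0 T))),
      MemLp (A.indicator (hG.1.mk G)) (ENNReal.ofReal p) volume := fun hG => by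
    rw [memLp_indicator_iff_restrict hAm]
    exact ((memLp_congr_ae hG.1.ae_eq_mk).1 hG).mono_measure
      (Measure.restrict_mono inter_subset_right le_rfl)
  refine ⟨fun t x z => if t ∈ A then f t x z else 0, A.indicator Km, A.indicator Lm, A, hAm, ?_,
    fun t ht => ?_, ?_, fun t => ?_, ?_, hLpm hKp, hLpm hLp, fun t => ?_, fun t x₁ x₂ z₁ z₂ => ?_⟩
  · have h1 : volume.restrict (Icc 0 T) Bᶜ = 0 := hB
    rw [Measure.restrict_apply hBm.compl] at h1
    refine measure_mono_null ?_ h1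
    exact fun t ht => ⟨fun h => ht.2 ⟨h, ht.1⟩, ht.1⟩
  · funext x z
    simp [ht]
  -- A Carathéodory function, continuous in space and measurable in time, is jointly measurable.
  · have h := measurable_uncurry_of_continuous_of_measurable
      (m := Real.measurableSpace) (u := fun (q : EuclideanSpace ℝ (Fin d) × EuclideanSpace ℝ (Fin d)) (t : ℝ) =>
        if t ∈ A then f t q.1 q.2 else 0) (fun t => ?_) fun q => ?_
    · exact h.comp measurable_swap
    · by_cases ht : t ∈ A
      · simpa [ht] using hf.continuous_space t ht.2
      · simpa [ht] using continuous_const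
    · have h1 : Measurable ((Icc (0 : ℝ) T).indicator fun t => f t q.1 q.2) := by
        refine measurable_of_restrict_of_restrict_compl (s := Icc (0 : ℝ) T) measurableSet_Icc ?_ ?_
        · convert hf.measurable_time q.1 q.2 using 1
          funext t
          simp [t.2]
        · convert measurable_const (a := (0 : EuclideanSpace ℝ (Fin d))) using 1
          funext t
          exact indicator_of_notMem t.2 _
      convert h1.indicator hAm using 1
      funext t
      by_cases ht : t ∈ A
      · simp [ht, indicator_of_mem ht.2]
      · simp [ht]
  · by_cases ht : t ∈ A
    · rw [indicator_of_mem ht, ← (hBeq t ht.1).2]; exact hL0 t ht.2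
    · rw [indicator_of_notMem ht]
  · exact hLp.1.stronglyMeasurable_mk.measurable.indicator hAm
  · by_cases ht : t ∈ A
    · rw [indicator_of_mem ht, ← (hBeq t ht.1).1]; simpa [ht] using hK t ht.2
    · simp [ht]
  · by_cases ht : t ∈ A
    · rw [indicator_of_mem ht, ← (hBeq t ht.1).2]; simpa [ht] using hL t ht.2 x₁ x₂ z₁ z₂
    · simp [ht]

/-! ### Transfer to the original right-hand side. -/

/-- The scheme sees the right-hand side only at its node times, so agreement there suffices, path by
path. -/
theorem eulerShifted_congr {d : ℕ}
    {f g : ℝ → EuclideanSpace ℝ (Fin d) → EuclideanSpace ℝ (Fin d) → EuclideanSpace ℝ (Fin d)}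
    {τ : ℝ} {x₀ : EuclideanSpace ℝ (Fin d)} {N n : ℕ} {u : ℕ → ℕ → ℝ}
    (h : ∀ j ≤ n, ∀ k < N, g (j * τ + k * (τ / N) + τ / N * u j k)
      = f (j * τ + k * (τ / N) + τ / N * u j k)) :
    ∀ j ≤ n + 1, ∀ k ≤ N, eulerShifted g τ x₀ N u j k = eulerShifted f τ x₀ N u j k := by
  intro j
  induction j with
  | zero => intro _ k _; rfl
  | succ j ihj =>
    intro hj k
    induction k with
    | zero =>
      intro _
      simp only [eulerShifted, eulerBlock]
      exact ihj (by omega) N le_rfl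
    | succ k ihk =>
      intro hk
      have h1 := ihk (by omega)
      have h2 := ihj (by omega) k (by omega)
      simp only [eulerShifted, eulerBlock] at h1 ⊢
      rw [h1, h2, h j (by omega) k (by omega)]

theorem theorem2 {d : ℕ} {Ω : Type*} [MeasurableSpace Ω] (P : Measure Ω) [IsProbabilityMeasure P]
    (γ : ℕ → ℕ → Ω → ℝ)
    (hγ_meas : ∀ j k, Measurable (γ j k))
    (hγ_unif : ∀ j k, pdf.IsUniform (γ j k) (Icc (0 : ℝ) 1) P volume)
    (hγ_indep : iIndepFun (fun q : ℕ × ℕ => γ q.1 q.2) P)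
    (n : ℕ) (τ : ℝ) (hτ : 0 < τ) (x₀ : EuclideanSpace ℝ (Fin d))
    (p α : ℝ) (hp : 2 ≤ p) (hα₀ : 0 < α) (hα₁ : α ≤ 1)
    (f : ℝ → EuclideanSpace ℝ (Fin d) → EuclideanSpace ℝ (Fin d) → EuclideanSpace ℝ (Fin d))
    (hf : LipHolderRHS f ((n + 1) * τ) p α)
    (x : ℝ → EuclideanSpace ℝ (Fin d))
    (hx : IsDDESolution f ((n + 1) * τ) τ x₀ x) :
    ∃ C : Fin (n + 1) → ℝ, (∀ j, 0 < C j) ∧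
      (∀ N : ℕ, ⌈τ⌉₊ ≤ N → ∀ j : Fin (n + 1),
        MemLp (maxError f τ x₀ x N γ j) (ENNReal.ofReal p) P ∧
        eLpNorm (maxError f τ x₀ x N γ j) (ENNReal.ofReal p) P ≤
          ENNReal.ofReal (C j * (τ / N) ^ (α ^ (j : ℕ) / 2))) ∧
      (α = 1 → ∀ N : ℕ, ⌈τ⌉₊ ≤ N → ∀ j : Fin (n + 1),
        eLpNorm (maxError f τ x₀ x N γ j) (ENNReal.ofReal p) P ≤
          ENNReal.ofReal (C j * (τ / N) ^ (1 / 2 : ℝ))) := by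
  have hp0 : 0 < p := by linarith
  set T : ℝ := (n + 1) * τ with hT
  have hT0 : 0 < T := by positivity
  obtain ⟨g, K, L, A, hAm, hA0, hgf, hgm, hL0, hLm, hKp, hLp, hgK, hgL⟩ := hf.exists_regularization
  -- the solution, extended to a continuous function on the real line
  set y : ℝ → EuclideanSpace ℝ (Fin d) := IccExtend hT0.le ((Icc 0 T).domRestrict x) with hy
  have hxcont : ContinuousOn x (Icc 0 T) := by
    simpa [uIcc_of_le hT0.le] using hx.absolutelyContinuous.continuousOn
  have hycont : Continuous y := hxcont.domRestrict.Icc_extend'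
  have hyx : ∀ t ∈ Icc 0 T, y t = x t := fun t ht => IccExtend_of_mem _ _ ht
  have hyinit : ∀ t ≤ 0, y t = x₀ := fun t ht => by
    rw [hy, IccExtend_of_le_left _ _ ht]
    exact hx.initial 0 ⟨by linarith, le_rfl⟩
  have hyx' : ∀ t ∈ Icc (-τ) T, y t = x t := fun t ht => by
    rcases le_total t 0 with h | h
    · rw [hyinit t h, hx.initial t ⟨ht.1, h⟩]
    · exact hyx t ⟨h, ht.2⟩
  obtain ⟨M, hM⟩ := isCompact_Icc.exists_bound_of_continuousOn hxcont
  have hyM : ∀ t, ‖y t‖ ≤ M := fun t => hM _ (projIcc 0 T hT0.le t).2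
  have hM0 : 0 ≤ M := (norm_nonneg _).trans (hyM 0)
  set F : ℝ → EuclideanSpace ℝ (Fin d) := fun s => g s (y s) (y (s - τ)) with hFdef
  have hFm : Measurable F := hgm.comp (measurable_id.prodMk
    (hycont.measurable.prodMk (hycont.measurable.comp (measurable_id.sub_const τ))))
  -- The solution is bounded by some `M` on `[0, T]`, so `F` is dominated by `K + L * (M + M ^ α)`.
  have hFp : MemLp F (ENNReal.ofReal p) volume := by
    refine (hKp.add (hLp.mul_const (M + M ^ α))).of_le hFm.aestronglyMeasurable
      (ae_of_all _ fun t => ?_)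
    have h1 := hgL t (y t) 0 (y (t - τ)) 0
    rw [sub_zero, sub_zero] at h1
    have h2 : L t * (‖y t‖ + ‖y (t - τ)‖ ^ α) ≤ L t * (M + M ^ α) := by
      have := hL0 t
      gcongr <;> exact hyM _
    have h3 : ‖F t‖ ≤ ‖F t - g t 0 0‖ + ‖g t 0 0‖ := by
      simpa using norm_add_le (F t - g t 0 0) (g t 0 0)
    refine le_trans ?_ (le_abs_self _)
    simp only [Pi.add_apply]
    linarith [hgK t]
  have hder : ∀ᵐ t ∂(volume.restrict (Icc 0 T)), HasDerivAt x (F t) t := by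
    have hmem : ∀ᵐ t ∂(volume.restrict (Icc 0 T)), t ∈ A := by
      rw [ae_iff, Measure.restrict_apply' measurableSet_Icc]
      refine measure_mono_null ?_ hA0
      exact fun t ht => ⟨ht.2, ht.1⟩
    filter_upwards [hx.equation, hmem, ae_restrict_mem measurableSet_Icc] with t h1 h2 h3
    rw [hFdef]
    simp only
    rw [hgf t h2, hyx t h3, hyx' (t - τ) ⟨by linarith [h3.1], by linarith [h3.2]⟩]
    exact h1
  have hFi : ∀ s t, IntervalIntegrable F volume s t := fun s t => by
    rw [intervalIntegrable_iff]
    have : IsFiniteMeasure (volume.restrict (uIoc s t)) := ⟨by simp [uIoc]⟩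
    refine (hFp.restrict (uIoc s t)).integrable ?_
    rw [← ENNReal.ofReal_one]
    exact ENNReal.ofReal_le_ofReal (by linarith)
  have hFTC : ∀ s t, 0 ≤ s → s ≤ t → t ≤ T → y t - y s = ∫ u in s..t, F u := by
    intro s t hs hst ht
    rw [hyx t ⟨hs.trans hst, ht⟩, hyx s ⟨hs, hst.trans ht⟩]
    refine (hx.absolutelyContinuous.mono ?_).sub_eq_integral_of_ae_hasDerivAt hst (hFi s t)
      (ae_restrict_of_ae_restrict_of_subset (Icc_subset_Icc hs ht) hder)
    rw [uIcc_of_le hst, uIcc_of_le hT0.le]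
    exact Icc_subset_Icc hs ht
  obtain ⟨κ, hκ, hmod⟩ := exists_norm_intervalIntegral_le_sqrt hp hFp T
  have hγ_mem : ∀ᵐ ω ∂P, ∀ j k, γ j k ω ∈ Icc (0 : ℝ) 1 := by
    rw [ae_all_iff]; intro j
    rw [ae_all_iff]; intro k
    have h : ∀ᵐ u ∂(P.map (γ j k)), u ∈ Icc (0 : ℝ) 1 := by
      rw [hγ_unif j k]
      exact ae_cond_mem measurableSet_Icc
    exact ae_of_ae_map (hγ_meas j k).aemeasurable h
  have hrate := exists_lintegral_sup_shiftedError_le_rate hγ_meas hγ_unif hγ_indep hγ_mem hτ hp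
    hα₀ hα₁ x₀ hycont.measurable hgm hL0 hLm hLp hgL hFp n hyinit hFTC hκ
    fun s t hs hst ht => by rw [hFTC s t hs hst ht]; exact hmod s t hs hst ht
  choose! C hC hCN using hrate
  -- Each node has an absolutely continuous law on a cell inside `[0, T]`, so almost surely none
  -- meets the exceptional times.
  have hgood : ∀ N : ℕ, 0 < N → ∀ᵐ ω ∂P, ∀ j ≤ n, ∀ k < N,
      j * τ + k * (τ / N) + τ / N * γ j k ω ∈ A := by
    intro N hN
    have hN' : (0 : ℝ) < N := Nat.cast_pos.2 hN
    have hh : 0 < τ / N := div_pos hτ hN'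
    rw [ae_all_iff]; intro j
    rw [ae_all_iff]; intro hj
    rw [ae_all_iff]; intro k
    rw [ae_all_iff]; intro hk
    have h : ∀ᵐ s ∂(P.map fun ω => j * τ + k * (τ / N) + τ / N * γ j k ω), s ∈ A := by
      rw [map_const_add_mul_of_isUniform (hγ_meas j k) (hγ_unif j k) _ hh]
      refine Measure.ae_smul_measure ?_ _
      rw [ae_iff, Measure.restrict_apply' measurableSet_Icc]
      refine measure_mono_null ?_ hA0
      refine fun s hs => ⟨⟨?_, ?_⟩, hs.1⟩
      · exact le_trans (by positivity) hs.2.1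
      · refine hs.2.2.trans ?_
        have h1 : ((k : ℝ) + 1) * (τ / N) ≤ N * (τ / N) := by
          gcongr; exact_mod_cast hk
        have h2 : N * (τ / N) = τ := by field_simp
        have h3 : (j : ℝ) * τ ≤ n * τ := by gcongr
        rw [hT]; linarith
    exact ae_of_ae_map (by have := hγ_meas j k; fun_prop) h
  have hmain : ∀ N : ℕ, ⌈τ⌉₊ ≤ N → ∀ j : Fin (n + 1),
      MemLp (maxError f τ x₀ x N γ j) (ENNReal.ofReal p) P ∧
      eLpNorm (maxError f τ x₀ x N γ j) (ENNReal.ofReal p) P ≤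
        ENNReal.ofReal (C j * (τ / N) ^ (α ^ (j : ℕ) / 2)) := by
    intro N hN j
    obtain ⟨hN0, hh, -⟩ := step_pos_and_le_one hτ hN
    have hj : (j : ℕ) ≤ n := Nat.lt_succ_iff.1 j.2
    set e : ℕ → Ω → EuclideanSpace ℝ (Fin d) :=
      fun i ω => shiftedError g τ x₀ y N (fun j k => γ j k ω) (j + 1) i with he
    have hem : ∀ i, Measurable (e i) := fun i => measurable_const.sub
      ((measurable_eulerShifted hgm τ x₀ N γ (j + 1) i).mono
        (iSup₂_le fun q _ => (hγ_meas q.1 q.2).comap_le) le_rfl)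
    have hae : maxError f τ x₀ x N γ j =ᵐ[P] fun ω =>
        (Finset.range (N + 1)).sup' Finset.nonempty_range_add_one fun i => ‖e i ω‖ := by
      filter_upwards [hgood N hN0] with ω hω
      refine Finset.sup'_congr _ rfl fun i hi => ?_
      have hi' : i ≤ N := Nat.lt_succ_iff.1 (Finset.mem_range.1 hi)
      rw [he]
      simp only [randomizedEuler, shiftedError, Nat.cast_add, Nat.cast_one, add_sub_cancel_right]
      rw [eulerShifted_congr (n := n) (fun j hj k hk => hgf _ (hω j hj k hk)) (j + 1) (by omega) i hi']
      rw [hyx]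
      have h1 : (i : ℝ) * (τ / N) ≤ N * (τ / N) := by gcongr
      have h2 : N * (τ / N) = τ := by
        have : (N : ℝ) ≠ 0 := by positivity
        field_simp
      have h3 : ((j : ℕ) : ℝ) * τ ≤ n * τ := by gcongr
      exact ⟨by positivity, by rw [hT]; linarith⟩
    have hbound : eLpNorm (maxError f τ x₀ x N γ j) (ENNReal.ofReal p) P ≤
        ENNReal.ofReal (C j * (τ / N) ^ (α ^ (j : ℕ) / 2)) := by
      have hq0 : ENNReal.ofReal p ≠ 0 := by simpa using hp0
      have hpos : 0 ≤ C j * (τ / N) ^ (α ^ (j : ℕ) / 2) :=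
        mul_nonneg (hC j hj).le (Real.rpow_nonneg hh.le _)
      rw [eLpNorm_congr_ae hae, eLpNorm_eq_lintegral_rpow_enorm_toReal hq0 ENNReal.ofReal_ne_top,
        ENNReal.toReal_ofReal hp0.le, one_div, ENNReal.rpow_inv_le_iff hp0,
        ENNReal.ofReal_rpow_of_nonneg hpos hp0.le]
      refine (lintegral_mono fun ω => ENNReal.rpow_le_rpow ?_ hp0.le).trans (hCN j hj N hN)
      obtain ⟨i, hi, hi'⟩ := Finset.exists_mem_eq_sup' Finset.nonempty_range_add_one
        (fun i => ‖e i ω‖) (s := Finset.range (N + 1))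
      rw [hi', enorm_norm]
      exact Finset.le_sup (f := fun i => ‖e i ω‖ₑ) hi
    -- Measurability of the error for `f` is obtained only up to a null set, from its agreement with
    -- the error for `g`.
    refine ⟨⟨?_, hbound.trans_lt ENNReal.ofReal_lt_top⟩, hbound⟩
    refine AEStronglyMeasurable.congr (Measurable.aestronglyMeasurable ?_) hae.symm
    exact Finset.measurable_range_sup'' fun i _ => (hem i).norm
  refine ⟨fun j => C j, fun j => hC j (Nat.lt_succ_iff.1 j.2), hmain, ?_⟩
  intro hα N hN j
  have h := (hmain N hN j).2
  rwa [hα, one_pow] at h
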